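/- Throughout, $\log$ is to base $2$. Words $w,v\in\Xi^n$ are $\epsilon$-far if there is no set $A\subseteq[n]$ with $|A|\le\epsilon n$ such that $w$ and $v$ agree outside $A$; a word is $\epsilon$-far from $L\subseteq\Xi^n$ if it is $\epsilon$-far from every word of $L$. A (2-sided) $(\epsilon,\delta)$-test for $L$ is a randomized query algorithm that accepts every $w\in L$ with probability at least $1-\delta$ and accepts every $w$ that is $\epsilon$-far from $L$ with probability at most $\delta$; it is non-adaptive if it draws its whole query set $Q$ before reading $w_Q$ and then decides according to $(Q,w_Q)$. A (2-sided) Merlin–Arthur proof of proximity (MAP) for $L$ with proximity parameter $\epsilon$, query complexity $q'$ and proof complexity $p$ is a randomized, possibly adaptive, algorithm that is given a proof string $\pi\in\Xi^p$, makes at most $q'$ queries to $w\in\Xi^n$, accepts every $w\in L$ with probability at least $2/3$ for some $\pi$, and accepts every $w$ that is $\epsilon$-far from $L$ with probability at most $1/3$ for every $\pi$. **Corollary.** For every $c>0$ there is $c'>0$, depending only on $c$, such that the following holds. Let $\Xi$ be a finite alphabet with $|\Xi|\ge 2$, let $0<\epsilon\le 1$, let $\gamma$ be a real number and $q'\ge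 1$ an integer, and put, with $\delta=1/3$, $$q=\frac{20\,q'\,\max\{1,\log q'\}\,\max\{1,\log\log\log(|\Xi|/\epsilon)\}}{(\frac12-\delta)^2},\qquad \alpha_2=\frac{10^3\ln(|\Xi|)\,q^4}{\epsilon}$$ (if $\log\log(|\Xi|/\epsilon)=0$, the second maximum is $1$). Let $n>\bigl(24q^{10}(\log|\Xi|)^2/\epsilon\bigr)^q$ and let $L\subseteq\Xi^n$. If every non-adaptive 2-sided $(\epsilon,1/10)$-test for $L$ needs at least $c\,n^{1-\gamma}$ queries, then every 2-sided MAP for $L$ with proximity parameter $\epsilon/2$ and query complexity $q'$ has proof complexity $p$ satisfying $$\max\{p,1\}\ \ge\ c'\cdot\frac{n^{q^{-2}-\gamma}}{10\,\alpha_2}.$$ -/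

import Mathlib

noncomputable section

namespace PropertyTesting

/-- The words `w` and `v` of length `n` are `ε`-far: one cannot make them agree by
ignoring a set `A` of at most `ε * n` indices. -/
def WordsFar {Ξ : Type*} {n : ℕ} (ε : ℝ) (w v : Fin n → Ξ) : Prop :=
  ¬ ∃ A : Finset (Fin n), (A.card : ℝ) ≤ ε * n ∧ ∀ i, i ∉ A → w i = v i

/-- The word `w` is `ε`-far from the property `L`: no word of `L` is `ε`-close to `w`. -/
def FarFrom {Ξ : Type*} {n : ℕ} (ε : ℝ) (w : Fin n → Ξ) (L : Set (Fin n → Ξ)) : Prop :=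
  ∀ v ∈ L, WordsFar ε w v

/-- A non-adaptive randomized algorithm with query access to a word of `Ξⁿ`: a set `Q` of
indices is drawn from a distribution, the sub-word `w_Q` is read, and the algorithm accepts with
a probability that depends on `(Q, w_Q)` only. -/
structure NonAdaptiveAlgorithm (Ξ : Type*) (n : ℕ) where
  /-- The distribution of the query set. -/
  queryDist : PMF (Finset (Fin n))
  /-- The probability of accepting, given the query set and the answers. -/
  accept : (Q : Finset (Fin n)) → (Q → Ξ) → Set.Icc (0 : ℝ) 1

/-- The probability that the algorithm accepts `w`. -/
def NonAdaptiveAlgorithm.acceptProb {Ξ : Type*} {n : ℕ} (A : NonAdaptiveAlgorithm Ξ n)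
    (w : Fin n → Ξ) : ℝ :=
  ∑ Q : Finset (Fin n), (A.queryDist Q).toReal * (A.accept Q (fun i => w i) : ℝ)

/-- The algorithm never makes more than `N` queries. -/
def NonAdaptiveAlgorithm.QueriesAtMost {Ξ : Type*} {n : ℕ} (A : NonAdaptiveAlgorithm Ξ n)
    (N : ℕ) : Prop :=
  ∀ Q ∈ A.queryDist.support, Q.card ≤ N

/-- The algorithm is a (`2`-sided) `(ε, δ)`-test for the property `L`. -/
def NonAdaptiveAlgorithm.IsTest {Ξ : Type*} {n : ℕ} (A : NonAdaptiveAlgorithm Ξ n)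
    (ε δ : ℝ) (L : Set (Fin n → Ξ)) : Prop :=
  (∀ w ∈ L, 1 - δ ≤ A.acceptProb w) ∧
  (∀ w, FarFrom ε w L → A.acceptProb w ≤ δ)

/-- A deterministic, possibly adaptive, query algorithm for words in `Ξⁿ`, given as a decision
tree: either it halts with an output (`true` is acceptance), or it queries an index and goes on
according to the letter read. -/
inductive QueryTree (Ξ : Type*) (n : ℕ) where
  | output (b : Bool) : QueryTree Ξ n
  | query (i : Fin n) (next : Ξ → QueryTree Ξ n) : QueryTree Ξ n

/-- The output of the algorithm on `w`. -/
def QueryTree.run {Ξ : Type*} {n : ℕ} : QueryTree Ξ n → (Fin n → Ξ) → Bool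
  | .output b, _ => b
  | .query i next, w => (next (w i)).run w

/-- The number of queries that the algorithm makes to `w`. -/
def QueryTree.numQueries {Ξ : Type*} {n : ℕ} : QueryTree Ξ n → (Fin n → Ξ) → ℕ
  | .output _, _ => 0
  | .query i next, w => (next (w i)).numQueries w + 1

/-- The probability that a randomized (possibly adaptive) query algorithm, that is a random
decision tree, accepts `w`. -/
def treeAcceptProb {Ξ : Type*} {n : ℕ} (A : PMF (QueryTree Ξ n)) (w : Fin n → Ξ) : ℝ :=
  ((A.map (fun T => T.run w)) true).toReal

/-- `V` is the verifier of a (`2`-sided) Merlin-Arthur proof of proximity for `L`, with proximity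
parameter `ε`, query complexity `q` and proof complexity `p`. On the proof string `π ∈ Ξᵖ`, the
verifier runs the randomized query algorithm `V π`. -/
structure IsMAP {Ξ : Type*} {n p : ℕ} (V : (Fin p → Ξ) → PMF (QueryTree Ξ n))
    (L : Set (Fin n → Ξ)) (ε : ℝ) (q : ℕ) : Prop where
  queries : ∀ π, ∀ T ∈ (V π).support, ∀ w, T.numQueries w ≤ q
  completeness : ∀ w ∈ L, ∃ π, 2 / 3 ≤ treeAcceptProb (V π) w
  soundness : ∀ w, FarFrom ε w L → ∀ π, treeAcceptProb (V π) w ≤ 1 / 3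

/-- The number `q = 20 q' log(q') log log log(k / ε) / (1/2 - δ)²`, for the error probability
`δ = 1/3` of a Merlin-Arthur proof of proximity and an alphabet of size `k`; logarithms are to
base `2`, and each of the two logarithmic factors is read as `1` if it is smaller than `1`. -/
def qParam (q' k : ℕ) (ε : ℝ) : ℝ :=
  20 * q' * max 1 (Real.logb 2 q') *
    max 1 (Real.logb 2 (Real.logb 2 (Real.logb 2 (k / ε)))) / (1 / 2 - 1 / 3) ^ 2

/-- The number `α₂ = 10³ ln(k) q⁴ / ε`. -/
def alphaTwo (q : ℝ) (k : ℕ) (ε : ℝ) : ℝ :=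
  10 ^ 3 * Real.log k * q ^ 4 / ε

/-- Every non-adaptive `2`-sided `(ε, δ)`-test for `L` needs at least `b` queries. -/
def NonAdaptiveTestsNeed {Ξ : Type*} {n : ℕ} (L : Set (Fin n → Ξ)) (ε δ b : ℝ) : Prop :=
  ∀ (A : NonAdaptiveAlgorithm Ξ n) (N : ℕ), A.QueriesAtMost N → A.IsTest ε δ L → b ≤ N

end PropertyTesting

end

/-! A MAP is turned into a non-adaptive test that reads a random set `S` of density `ρ = n^(-1/q²)`;
comparison with the assumed lower bound for tests then bounds `p` from below. Repetition first
reduces the error `δ` of the verifier to at most `1/(16(Q+1))`, where the new number `Q` of queries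
still satisfies `Q + 1 ≤ q/2`. One sample must then serve all proofs `π` at once.

Query sets that crowd on a few popular indices would ruin concentration. So take thresholds `θ₀ ≤ θ₁
≤ …` and let the kernel `K_j` consist of the indices read with probability at least `θ_j`; it has at
most `Q/θ_j` elements. For each accepting run, the least `j` with at most `j` queries outside `K_j`
gives exactly `j` queries outside `K_j`, none of them in `K_{j-1}` (`exists_mem_daisy`). Hence some
level carries a `1/(Q+1)` share of the accepting weight, and its petals, the queries outside the
kernel, have degree at most `θ_{j-1}`, far below `θ_j`.

The letters on the kernel are not sampled, so they are guessed: the test accepts if for some `π`,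
`j` and some word `v` agreeing with `w` on `S`, the daisy of `v` has weight at least `2aρ^j` inside
`S`. For `w ∈ L` the choice `v = w` succeeds by the second moment method (`subsetProb_lower_tail`).
If `w` is far from `L`, overwriting it on the small kernel by the letters of `v` leaves it
`ε/2`-far, and the petals found in `S` come from accepting runs on the overwritten word, of total
weight at most `δ`. By `subsetProb_upper_tail` such an excess has probability at most `2^(-m)`, and
`m` beats the union bound over the proof, the level, the kernel and its letters.

This needs `max p 1 ≤ n^(1/q²)`; otherwise reading all of `w` is cheap enough. In both cases `20 ·
max p 1 · n^(1-1/q²)` queries suffice. -/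

noncomputable section

namespace PropertyTesting

open Finset

/-! ### Random subsets of density `ρ` -/

section RandomSubset

variable {α : Type*} [Fintype α] [DecidableEq α]

/-- The probability that a random subset of `α`, which contains each point independently with
probability `ρ`, is equal to `S`. -/
def subsetWeight (ρ : ℝ) (S : Finset α) : ℝ :=
  (∏ _i ∈ S, ρ) * ∏ _i ∈ univ \ S, (1 - ρ)

/-- The probability of an event for a random subset of density `ρ`. -/
def subsetProb (ρ : ℝ) (E : Finset α → Prop) : ℝ :=
  open Classical in ∑ S : Finset α, if E S then subsetWeight ρ S else 0

theorem subsetWeight_nonneg {ρ : ℝ} (h0 : 0 ≤ ρ) (h1 : ρ ≤ 1) (S : Finset α) :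
    0 ≤ subsetWeight ρ S :=
  mul_nonneg (prod_nonneg fun _ _ => h0) (prod_nonneg fun _ _ => sub_nonneg.2 h1)

/-- Expand the product over `i` of `ρ + (1 - ρ)`, with the second term deleted for `i ∈ P`: the
surviving terms are the supersets of `P`. -/
theorem sum_subsetWeight_superset (ρ : ℝ) (P : Finset α) :
    ∑ S : Finset α, (if P ⊆ S then subsetWeight ρ S else 0) = ρ ^ P.card := by
  have h := Finset.prod_add (fun _ : α => ρ) (fun i => if i ∈ P then 0 else 1 - ρ) univ
  rw [powerset_univ] at h
  have hl : ∏ i : α, (ρ + if i ∈ P then 0 else 1 - ρ) = ρ ^ P.card := by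
    have : ∀ i : α, (ρ + if i ∈ P then 0 else 1 - ρ) = if i ∈ P then ρ else 1 := by
      intro i; split_ifs <;> ring
    simp [this]
  rw [← hl, h]
  refine sum_congr rfl fun S _ => ?_
  split_ifs with hP
  · unfold subsetWeight
    congr 1
    refine prod_congr rfl fun i hi => ?_
    rw [if_neg]
    intro hiP
    exact (mem_sdiff.1 hi).2 (hP hiP)
  · obtain ⟨i, hi, hiS⟩ := not_subset.1 hP
    rw [prod_eq_zero (i := i) (s := univ \ S) (by simp [hiS]) (by simp [hi]), mul_zero]

theorem sum_subsetWeight (ρ : ℝ) : ∑ S : Finset α, subsetWeight ρ S = 1 := by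
  simpa using sum_subsetWeight_superset ρ (∅ : Finset α)

theorem sum_subsetWeight_mul_card (ρ : ℝ) :
    ∑ S : Finset α, subsetWeight ρ S * S.card = Fintype.card α * ρ := by
  have h : ∀ S : Finset α, subsetWeight ρ S * S.card
      = ∑ i : α, if {i} ⊆ S then subsetWeight ρ S else 0 := by
    intro S
    simp [mul_comm]
  simp_rw [h]
  rw [sum_comm]
  simp_rw [sum_subsetWeight_superset]
  simp

section

variable {ρ : ℝ} (h0 : 0 ≤ ρ) (h1 : ρ ≤ 1)
include h0 h1

theorem subsetProb_mono {E F : Finset α → Prop} (h : ∀ S, E S → F S) :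
    subsetProb ρ E ≤ subsetProb ρ F := by
  classical
  refine sum_le_sum fun S _ => ?_
  have := subsetWeight_nonneg h0 h1 S
  split_ifs with hE hF <;> first | exact le_rfl | exact this | exact absurd (h S hE) hF

theorem subsetProb_or_le (E F : Finset α → Prop) :
    subsetProb ρ (fun S => E S ∨ F S) ≤ subsetProb ρ E + subsetProb ρ F := by
  classical
  unfold subsetProb
  rw [← sum_add_distrib]
  refine sum_le_sum fun S _ => ?_
  have := subsetWeight_nonneg h0 h1 S
  by_cases hE : E S <;> by_cases hF : F S <;> simp [hE, hF, this]

theorem subsetProb_exists_le {ι : Type*} (s : Finset ι) (E : ι → Finset α → Prop) :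
    subsetProb ρ (fun S => ∃ i ∈ s, E i S) ≤ ∑ i ∈ s, subsetProb ρ (E i) := by
  classical
  unfold subsetProb
  rw [sum_comm]
  refine sum_le_sum fun S _ => ?_
  have hw := subsetWeight_nonneg h0 h1 S
  have hn : ∀ i ∈ s, 0 ≤ if E i S then subsetWeight ρ S else 0 := by
    intro i _
    split_ifs <;> first | exact le_rfl | exact hw
  split_ifs with h
  · obtain ⟨i, hi, hE⟩ := h
    calc subsetWeight ρ S = if E i S then subsetWeight ρ S else 0 := by rw [if_pos hE]
      _ ≤ _ := single_le_sum hn hi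
  · exact sum_nonneg hn

/-- Markov's inequality for a random subset. -/
theorem subsetProb_markov {E : Finset α → Prop} {f : Finset α → ℝ} {b c : ℝ} (hb : 0 < b)
    (hf : ∀ S, 0 ≤ f S) (hE : ∀ S, E S → b ≤ f S)
    (hc : ∑ S : Finset α, subsetWeight ρ S * f S ≤ c) : subsetProb ρ E ≤ c / b := by
  classical
  rw [le_div_iff₀ hb]
  refine le_trans ?_ hc
  unfold subsetProb
  rw [sum_mul]
  refine sum_le_sum fun S _ => ?_
  have hw := subsetWeight_nonneg h0 h1 S
  split_ifs with h
  · exact mul_le_mul_of_nonneg_left (hE S h) hw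
  · rw [zero_mul]; exact mul_nonneg hw (hf S)

end

theorem subsetProb_not (ρ : ℝ) (E : Finset α → Prop) :
    subsetProb ρ (fun S => ¬ E S) = 1 - subsetProb ρ E := by
  classical
  rw [eq_sub_iff_add_eq, ← sum_subsetWeight (α := α) ρ]
  unfold subsetProb
  rw [← sum_add_distrib]
  refine sum_congr rfl fun S _ => ?_
  by_cases hE : E S <;> simp [hE]

end RandomSubset

/-! ### Tail bounds for the weight of a set family inside a random subset -/

section Tails

variable {α Ω : Type*} [Fintype α] [DecidableEq α]

/-- The total weight of the members of the set family `P ω`, `ω ∈ B`, that are contained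
in `S`. -/
def weightInside (B : Finset Ω) (μ : Ω → ℝ) (P : Ω → Finset α) (S : Finset α) : ℝ :=
  ∑ ω ∈ B, if P ω ⊆ S then μ ω else 0

/-- All points of `α` have degree at most `θ` in the weighted set family `P ω`, `ω ∈ B`. -/
def DegreeLE (B : Finset Ω) (μ : Ω → ℝ) (P : Ω → Finset α) (θ : ℝ) : Prop :=
  ∀ i : α, ∑ ω ∈ B, (if i ∈ P ω then μ ω else 0) ≤ θ

omit [Fintype α] in
/-- The weight of the members that meet `U` is at most `θ` times the size of `U`. -/
theorem DegreeLE.sum_not_disjoint_le {B : Finset Ω} {μ : Ω → ℝ} {P : Ω → Finset α} {θ : ℝ}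
    (h : DegreeLE B μ P θ) (hμ : ∀ ω, 0 ≤ μ ω) (U : Finset α) :
    ∑ ω ∈ B, (if Disjoint U (P ω) then 0 else μ ω) ≤ U.card * θ := by
  calc ∑ ω ∈ B, (if Disjoint U (P ω) then 0 else μ ω)
      ≤ ∑ ω ∈ B, ∑ i ∈ U, (if i ∈ P ω then μ ω else 0) := by
        refine sum_le_sum fun ω _ => ?_
        have hn : ∀ i ∈ U, 0 ≤ if i ∈ P ω then μ ω else 0 := by
          intro i _
          split_ifs <;> first | exact le_rfl | exact hμ ω
        split_ifs with hd
        · exact sum_nonneg hn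
        · obtain ⟨i, hi, hiP⟩ := not_disjoint_iff.1 hd
          calc μ ω = if i ∈ P ω then μ ω else 0 := by rw [if_pos hiP]
            _ ≤ _ := single_le_sum hn hi
    _ = ∑ i ∈ U, ∑ ω ∈ B, (if i ∈ P ω then μ ω else 0) := sum_comm
    _ ≤ ∑ i ∈ U, θ := sum_le_sum fun i _ => h i
    _ = U.card * θ := by simp

/-- The total weight of the `m`-tuples of members of the family that are contained in `S`
and are disjoint from each other and from `U`. -/
def disjointTuples (B : Finset Ω) (μ : Ω → ℝ) (P : Ω → Finset α) (S : Finset α) :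
    ℕ → Finset α → ℝ
  | 0, _ => 1
  | m + 1, U => ∑ ω ∈ B, if Disjoint U (P ω) ∧ P ω ⊆ S then
      μ ω * disjointTuples B μ P S m (U ∪ P ω) else 0

variable {B : Finset Ω} {μ : Ω → ℝ} {P : Ω → Finset α} {j : ℕ} {ρ : ℝ}

omit [Fintype α] in
theorem disjointTuples_nonneg (hμ : ∀ ω, 0 ≤ μ ω) (S : Finset α) (m : ℕ) (U : Finset α) :
    0 ≤ disjointTuples B μ P S m U := by
  induction m generalizing U with
  | zero => simp [disjointTuples]
  | succ m ih =>
    refine sum_nonneg fun ω _ => ?_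
    split_ifs
    · exact mul_nonneg (hμ ω) (ih _)
    · exact le_rfl

/-- Each new member is disjoint from the points already used, so its containment in `S` costs an
independent factor `ρ ^ j`; induct with the used points collected in `U`. -/
theorem expectation_disjointTuples_le (hμ : ∀ ω, 0 ≤ μ ω) (h0 : 0 ≤ ρ)
    (hP : ∀ ω ∈ B, (P ω).card = j) (m : ℕ) (U : Finset α) :
    ∑ S : Finset α, (if U ⊆ S then subsetWeight ρ S * disjointTuples B μ P S m U else 0)
      ≤ ((∑ ω ∈ B, μ ω) * ρ ^ j) ^ m * ρ ^ U.card := by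
  induction m generalizing U with
  | zero => simp [disjointTuples, sum_subsetWeight_superset]
  | succ m ih =>
    set M := ∑ ω ∈ B, μ ω
    have hM : 0 ≤ M := sum_nonneg fun ω _ => hμ ω
    calc ∑ S : Finset α, (if U ⊆ S then subsetWeight ρ S * disjointTuples B μ P S (m + 1) U
          else 0)
        = ∑ ω ∈ B, if Disjoint U (P ω) then μ ω * ∑ S : Finset α, (if U ∪ P ω ⊆ S then
            subsetWeight ρ S * disjointTuples B μ P S m (U ∪ P ω) else 0) else 0 := by
          have : ∀ S : Finset α, (if U ⊆ S then
              subsetWeight ρ S * disjointTuples B μ P S (m + 1) U else 0)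
              = ∑ ω ∈ B, if Disjoint U (P ω) then μ ω * (if U ∪ P ω ⊆ S then
            subsetWeight ρ S * disjointTuples B μ P S m (U ∪ P ω) else 0) else 0 := by
            intro S
            split_ifs with hU
            · rw [disjointTuples, mul_sum]
              refine sum_congr rfl fun ω _ => ?_
              by_cases hd : Disjoint U (P ω) <;> by_cases hs : P ω ⊆ S <;>
                simp [hd, hs, hU, union_subset_iff]
              ring
            · refine (sum_eq_zero fun ω _ => ?_).symm
              simp [hU, union_subset_iff]
          simp_rw [this]
          rw [sum_comm]
          refine sum_congr rfl fun ω _ => ?_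
          split_ifs
          · rw [mul_sum]
          · simp
      _ ≤ ∑ ω ∈ B, μ ω * ((M * ρ ^ j) ^ m * ρ ^ (U.card + j)) := by
          refine sum_le_sum fun ω hω => ?_
          split_ifs with hd
          · refine mul_le_mul_of_nonneg_left ((ih _).trans_eq ?_) (hμ ω)
            rw [card_union_of_disjoint hd, hP ω hω]
          · have := hμ ω
            positivity
      _ = (M * ρ ^ j) ^ (m + 1) * ρ ^ U.card := by
          rw [← sum_mul]
          ring

omit [Fintype α] in
-- Greedy choice: the points used so far number at most `M * j`, so by the degree bound they spoil
-- weight at most `b` out of `2 * b`, and weight `b` remains for each next member. Degrees are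
-- bounded only in `B'`, which may depend on `S`, while the tuples are counted in the fixed family
-- `B`.
theorem pow_le_disjointTuples {B' : Finset Ω} {S : Finset α} {b θ : ℝ} (hμ : ∀ ω, 0 ≤ μ ω)
    (hP : ∀ ω ∈ B, (P ω).card = j) (hB : B' ⊆ B) (hdeg : DegreeLE B' μ P θ) (hθ : 0 ≤ θ)
    (hb : 0 ≤ b) (hS : 2 * b ≤ weightInside B' μ P S) (M : ℕ) (hM : M * j * θ ≤ b) (m : ℕ)
    (U : Finset α) (hmM : m ≤ M) (hU : U.card ≤ j * (M - m)) :
    b ^ m ≤ disjointTuples B μ P S m U := by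
  induction m generalizing U with
  | zero => simp [disjointTuples]
  | succ m ih =>
    have hn := fun V => disjointTuples_nonneg (B := B) (P := P) hμ S m V
    have key : b ≤ ∑ ω ∈ B', if Disjoint U (P ω) ∧ P ω ⊆ S then μ ω else 0 := by
      have h1 := hdeg.sum_not_disjoint_le hμ U
      have h2 : weightInside B' μ P S ≤ ∑ ω ∈ B', (if Disjoint U (P ω) then 0 else μ ω)
          + ∑ ω ∈ B', (if Disjoint U (P ω) ∧ P ω ⊆ S then μ ω else 0) := by
        unfold weightInside
        rw [← sum_add_distrib]
        refine sum_le_sum fun ω _ => ?_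
        have := hμ ω
        by_cases hd : Disjoint U (P ω) <;> by_cases hs : P ω ⊆ S <;> simp [hd, hs, this]
      have h3 : (U.card : ℝ) * θ ≤ b := by
        refine le_trans ?_ hM
        refine mul_le_mul_of_nonneg_right ?_ hθ
        have : U.card ≤ M * j := hU.trans (by rw [mul_comm]; gcongr; omega)
        exact_mod_cast this
      linarith
    calc b ^ (m + 1) = b * b ^ m := by ring
      _ ≤ (∑ ω ∈ B', if Disjoint U (P ω) ∧ P ω ⊆ S then μ ω else 0) * b ^ m := by gcongr
      _ = ∑ ω ∈ B', if Disjoint U (P ω) ∧ P ω ⊆ S then μ ω * b ^ m else 0 := by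
          rw [sum_mul]
          exact sum_congr rfl fun ω _ => by split_ifs <;> simp
      _ ≤ ∑ ω ∈ B', if Disjoint U (P ω) ∧ P ω ⊆ S then
            μ ω * disjointTuples B μ P S m (U ∪ P ω) else 0 := by
          refine sum_le_sum fun ω hω => ?_
          split_ifs with h
          · refine mul_le_mul_of_nonneg_left (ih _ (by omega) ?_) (hμ ω)
            rw [card_union_of_disjoint h.1, hP ω (hB hω)]
            calc U.card + j ≤ j * (M - (m + 1)) + j := by gcongr
              _ = j * (M - (m + 1) + 1) := by ring
              _ = j * (M - m) := by congr 1; omega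
          · exact le_rfl
      _ ≤ disjointTuples B μ P S (m + 1) U := by
          rw [disjointTuples]
          refine sum_le_sum_of_subset_of_nonneg hB fun ω _ _ => ?_
          split_ifs
          · exact mul_nonneg (hμ ω) (hn _)
          · exact le_rfl

/-- Upper tail by the deletion method: it is unlikely that a random set contains
much more weight than expected of some subfamily of bounded degree. -/
theorem subsetProb_upper_tail {b θ : ℝ} {m : ℕ} (hμ : ∀ ω, 0 ≤ μ ω) (h0 : 0 ≤ ρ) (h1 : ρ ≤ 1)
    (hP : ∀ ω ∈ B, (P ω).card = j) (hθ : 0 ≤ θ) (hb : 0 < b) (hm : m * j * θ ≤ b) :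
    subsetProb ρ (fun S => ∃ B' ⊆ B, DegreeLE B' μ P θ ∧ 2 * b ≤ weightInside B' μ P S)
      ≤ ((∑ ω ∈ B, μ ω) * ρ ^ j / b) ^ m := by
  have h := expectation_disjointTuples_le (B := B) (P := P) hμ h0 hP m ∅
  simp only [empty_subset, if_true, card_empty, pow_zero, mul_one] at h
  rw [div_pow]
  refine subsetProb_markov h0 h1 (pow_pos hb m)
    (fun S => disjointTuples_nonneg hμ S m ∅) ?_ h
  rintro S ⟨B', hB, hd, hS⟩
  exact pow_le_disjointTuples hμ hP hB hd hθ hb.le hS m hm m ∅ le_rfl (by simp)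

/-- Lower tail by the second moment method. -/
theorem subsetProb_lower_tail {θ : ℝ} (hμ : ∀ ω, 0 ≤ μ ω) (h0 : 0 < ρ) (h1 : ρ ≤ 1)
    (hP : ∀ ω ∈ B, (P ω).card = j) (hdeg : DegreeLE B μ P θ) (hB : 0 < ∑ ω ∈ B, μ ω) :
    subsetProb ρ (fun S => ¬ (∑ ω ∈ B, μ ω) * ρ ^ j / 2 ≤ weightInside B μ P S)
      ≤ 4 * j * θ / ((∑ ω ∈ B, μ ω) * ρ ^ j) := by
  set M := ∑ ω ∈ B, μ ω with hMdef
  have hρ : 0 < ρ ^ j := pow_pos h0 j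
  have hM1 : ∑ S : Finset α, subsetWeight ρ S * weightInside B μ P S = M * ρ ^ j := by
    have : ∀ S : Finset α, subsetWeight ρ S * weightInside B μ P S
        = ∑ ω ∈ B, μ ω * (if P ω ⊆ S then subsetWeight ρ S else 0) := by
      intro S
      unfold weightInside
      rw [mul_sum]
      exact sum_congr rfl fun ω _ => by split_ifs <;> ring
    simp_rw [this]
    rw [sum_comm]
    simp_rw [← mul_sum, sum_subsetWeight_superset]
    rw [hMdef, sum_mul]
    exact sum_congr rfl fun ω hω => by rw [hP ω hω]
  have hM2 : ∑ S : Finset α, subsetWeight ρ S * weightInside B μ P S ^ 2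
      = ∑ ω ∈ B, ∑ ω' ∈ B, μ ω * μ ω' * ρ ^ (P ω ∪ P ω').card := by
    have : ∀ S : Finset α, subsetWeight ρ S * weightInside B μ P S ^ 2
        = ∑ ω ∈ B, ∑ ω' ∈ B,
          μ ω * μ ω' * (if P ω ∪ P ω' ⊆ S then subsetWeight ρ S else 0) := by
      intro S
      unfold weightInside
      rw [sq, sum_mul_sum, mul_sum]
      refine sum_congr rfl fun ω _ => ?_
      rw [mul_sum]
      refine sum_congr rfl fun ω' _ => ?_
      by_cases ha : P ω ⊆ S <;> by_cases hb : P ω' ⊆ S <;> simp [ha, hb, union_subset_iff]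
      ring
    simp_rw [this]
    rw [sum_comm]
    refine sum_congr rfl fun ω _ => ?_
    rw [sum_comm]
    refine sum_congr rfl fun ω' _ => ?_
    rw [← mul_sum, sum_subsetWeight_superset]
  -- Disjoint pairs contribute what independence would give. A pair that meets contributes at most
  -- `ρ ^ j`, and the degree bound limits the weight of the members meeting a given one to `j * θ`.
  have hM2' : ∑ S : Finset α, subsetWeight ρ S * weightInside B μ P S ^ 2
      ≤ M * (M * ρ ^ (2 * j) + j * θ * ρ ^ j) := by
    rw [hM2]
    calc _ ≤ ∑ ω ∈ B, μ ω * (M * ρ ^ (2 * j) + j * θ * ρ ^ j) := by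
          refine sum_le_sum fun ω hω => ?_
          have hd := hdeg.sum_not_disjoint_le hμ (P ω)
          rw [hP ω hω] at hd
          calc ∑ ω' ∈ B, μ ω * μ ω' * ρ ^ (P ω ∪ P ω').card
              ≤ ∑ ω' ∈ B, μ ω * (μ ω' * ρ ^ (2 * j)
                  + (if Disjoint (P ω) (P ω') then 0 else μ ω') * ρ ^ j) := by
                refine sum_le_sum fun ω' hω' => ?_
                rw [mul_assoc]
                refine mul_le_mul_of_nonneg_left ?_ (hμ ω)
                have hm' := hμ ω'
                split_ifs with hdis
                · rw [card_union_of_disjoint hdis, hP ω hω, hP ω' hω', ← two_mul]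
                  simp
                · have hc : j ≤ (P ω ∪ P ω').card := by
                    rw [← hP ω hω]; exact card_le_card subset_union_left
                  have := mul_le_mul_of_nonneg_left (pow_le_pow_of_le_one h0.le h1 hc) hm'
                  have h2 : 0 ≤ μ ω' * ρ ^ (2 * j) := by positivity
                  linarith
            _ = μ ω * (M * ρ ^ (2 * j)
                  + (∑ ω' ∈ B, if Disjoint (P ω) (P ω') then 0 else μ ω') * ρ ^ j) := by
                rw [← mul_sum, sum_add_distrib, ← sum_mul, ← sum_mul]
            _ ≤ _ := by
                refine mul_le_mul_of_nonneg_left ?_ (hμ ω)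
                gcongr
      _ = _ := by rw [← sum_mul]
  have hvar : ∑ S : Finset α, subsetWeight ρ S * (weightInside B μ P S - M * ρ ^ j) ^ 2
      ≤ M * (j * θ * ρ ^ j) := by
    have : ∀ S : Finset α, subsetWeight ρ S * (weightInside B μ P S - M * ρ ^ j) ^ 2
        = subsetWeight ρ S * weightInside B μ P S ^ 2
          - 2 * (M * ρ ^ j) * (subsetWeight ρ S * weightInside B μ P S)
          + (M * ρ ^ j) ^ 2 * subsetWeight ρ S := by
      intro S; ring
    simp_rw [this]
    rw [sum_add_distrib, sum_sub_distrib, ← mul_sum, ← mul_sum, hM1, sum_subsetWeight]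
    have e : ρ ^ (2 * j) = (ρ ^ j) ^ 2 := by rw [mul_comm, pow_mul]
    rw [e] at hM2'
    nlinarith [hM2']
  have hpos : 0 < (M * ρ ^ j / 2) ^ 2 := by positivity
  refine (subsetProb_markov h0.le h1 hpos (fun S => sq_nonneg _) ?_ hvar).trans_eq ?_
  · intro S hS
    have : 0 < M * ρ ^ j := by positivity
    nlinarith [not_le.1 hS]
  · field_simp
    ring

end Tails

/-! ### Local algorithms and amplification -/

/-- A randomized query algorithm with a finite set `Ω` of outcomes of its coins. On the outcome
`ω` it reads the indices `queried ω w` of the word `w`; the set of these indices and the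
decision are determined by the letters read. -/
structure LocalAlgorithm (Ω Ξ : Type*) [Fintype Ω] (n : ℕ) where
  /-- The probability of an outcome. -/
  weight : Ω → ℝ
  weight_nonneg : ∀ ω, 0 ≤ weight ω
  sum_weight : ∑ ω, weight ω = 1
  /-- The set of indices that are read. -/
  queried : Ω → (Fin n → Ξ) → Finset (Fin n)
  /-- The decision. -/
  accepts : Ω → (Fin n → Ξ) → Bool
  queried_congr : ∀ ω v w, (∀ i ∈ queried ω v, v i = w i) → queried ω w = queried ω v
  accepts_congr : ∀ ω v w, (∀ i ∈ queried ω v, v i = w i) → accepts ω w = accepts ω v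

namespace LocalAlgorithm

variable {Ω Ξ : Type*} [Fintype Ω] {n : ℕ}

/-- The probability that the algorithm accepts `w`. -/
def acceptProb (A : LocalAlgorithm Ω Ξ n) (w : Fin n → Ξ) : ℝ :=
  ∑ ω, if A.accepts ω w then A.weight ω else 0

/-- The algorithm never reads more than `N` indices. -/
def QueriesAtMost (A : LocalAlgorithm Ω Ξ n) (N : ℕ) : Prop :=
  ∀ ω w, (A.queried ω w).card ≤ N

/-- `2 * r` independent runs of the algorithm, accepting if at least `r` of them accept. -/
def amplify (A : LocalAlgorithm Ω Ξ n) (r : ℕ) : LocalAlgorithm (Fin (2 * r) → Ω) Ξ n where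
  weight σ := ∏ i, A.weight (σ i)
  weight_nonneg σ := prod_nonneg fun i _ => A.weight_nonneg _
  sum_weight := by rw [← Fintype.sum_pow, A.sum_weight, one_pow]
  queried σ w := univ.biUnion fun i => A.queried (σ i) w
  accepts σ w := decide (r ≤ (univ.filter fun i => A.accepts (σ i) w = true).card)
  queried_congr σ v w h := by
    have : ∀ i, A.queried (σ i) w = A.queried (σ i) v := fun i =>
      A.queried_congr _ _ _ fun x hx => h x (mem_biUnion.2 ⟨i, mem_univ i, hx⟩)
    simp_rw [this]
  accepts_congr σ v w h := by
    have : ∀ i, A.accepts (σ i) w = A.accepts (σ i) v := fun i =>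
      A.accepts_congr _ _ _ fun x hx => h x (mem_biUnion.2 ⟨i, mem_univ i, hx⟩)
    simp_rw [this]

theorem QueriesAtMost.amplify {A : LocalAlgorithm Ω Ξ n} {N : ℕ} (h : A.QueriesAtMost N)
    (r : ℕ) : (A.amplify r).QueriesAtMost (2 * r * N) := by
  intro σ w
  refine card_biUnion_le.trans ((sum_le_sum fun i _ => h (σ i) w).trans_eq ?_)
  simp

end LocalAlgorithm

/-- If an event has probability at most `1/3`, then it is exponentially unlikely to occur in at
least half of `2 * r` independent runs. -/
theorem sum_prod_le_of_half {Ω : Type*} [Fintype Ω] {μ : Ω → ℝ} (hμ : ∀ ω, 0 ≤ μ ω)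
    (hsum : ∑ ω, μ ω = 1) (E : Ω → Prop) [DecidablePred E]
    (hE : ∑ ω, (if E ω then μ ω else 0) ≤ 1 / 3) (r : ℕ) :
    ∑ σ : Fin (2 * r) → Ω, (if r ≤ (univ.filter fun i => E (σ i)).card then ∏ i, μ (σ i) else 0)
      ≤ (8 / 9) ^ r := by
  -- Exponential Markov inequality: a factor `2` per occurrence has mean at most `4/3` in each run,
  -- and `(4/3)² / 2 = 8/9`.
  have hbase : ∑ ω, μ ω * (if E ω then 2 else 1) ≤ 4 / 3 := by
    have : ∀ ω, μ ω * (if E ω then 2 else 1) = μ ω + if E ω then μ ω else 0 := by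
      intro ω; split_ifs <;> ring
    simp_rw [this]
    rw [sum_add_distrib, hsum]
    linarith
  have hbase0 : 0 ≤ ∑ ω, μ ω * (if E ω then 2 else 1) :=
    sum_nonneg fun ω _ => mul_nonneg (hμ ω) (by split_ifs <;> norm_num)
  calc _ ≤ ∑ σ : Fin (2 * r) → Ω, (∏ i, (μ (σ i) * (if E (σ i) then 2 else 1))) / 2 ^ r := by
        refine sum_le_sum fun σ _ => ?_
        have h0 : 0 ≤ ∏ i, μ (σ i) := prod_nonneg fun i _ => hμ _
        rw [prod_mul_distrib, prod_ite]
        simp only [prod_const, one_pow, mul_one]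
        split_ifs with h
        · rw [le_div_iff₀ (by positivity)]
          exact mul_le_mul_of_nonneg_left (pow_le_pow_right₀ one_le_two h) h0
        · positivity
    _ = (∑ ω, μ ω * (if E ω then 2 else 1)) ^ (2 * r) / 2 ^ r := by
        rw [← sum_div, Fintype.sum_pow]
    _ ≤ (4 / 3) ^ (2 * r) / 2 ^ r := by gcongr
    _ = (8 / 9) ^ r := by
        rw [pow_mul, ← div_pow]
        norm_num

namespace LocalAlgorithm

variable {Ω Ξ : Type*} [Fintype Ω] {n : ℕ} (A : LocalAlgorithm Ω Ξ n)

theorem acceptProb_amplify_le (r : ℕ) {w : Fin n → Ξ} (h : A.acceptProb w ≤ 1 / 3) :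
    (A.amplify r).acceptProb w ≤ (8 / 9) ^ r := by
  refine le_trans (le_of_eq ?_)
    (sum_prod_le_of_half A.weight_nonneg A.sum_weight (fun ω => A.accepts ω w = true) h r)
  simp [acceptProb, amplify]

theorem le_acceptProb_amplify (r : ℕ) {w : Fin n → Ξ} (h : 2 / 3 ≤ A.acceptProb w) :
    1 - (8 / 9) ^ r ≤ (A.amplify r).acceptProb w := by
  have hrej : ∑ ω, (if A.accepts ω w = false then A.weight ω else 0) ≤ 1 / 3 := by
    have : ∑ ω, (if A.accepts ω w = false then A.weight ω else 0) + A.acceptProb w = 1 := by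
      rw [← A.sum_weight, acceptProb, ← sum_add_distrib]
      refine sum_congr rfl fun ω _ => ?_
      cases A.accepts ω w <;> simp
    linarith
  have h1 := sum_prod_le_of_half A.weight_nonneg A.sum_weight
    (fun ω => A.accepts ω w = false) hrej r
  -- Among `2 * r` runs, at least `r` accept or at least `r` reject.
  have h2 : 1 ≤ (A.amplify r).acceptProb w + ∑ σ : Fin (2 * r) → Ω,
      (if r ≤ (univ.filter fun i => A.accepts (σ i) w = false).card
        then ∏ i, A.weight (σ i) else 0) := by
    rw [← (A.amplify r).sum_weight, acceptProb, ← sum_add_distrib]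
    refine sum_le_sum fun σ _ => ?_
    have h0 := (A.amplify r).weight_nonneg σ
    have hc := card_filter_add_card_filter_not (s := (univ : Finset (Fin (2 * r))))
      (fun i => A.accepts (σ i) w = true)
    simp only [Bool.not_eq_true, card_univ, Fintype.card_fin] at hc
    have h0' : 0 ≤ ∏ i, A.weight (σ i) := h0
    simp only [amplify, decide_eq_true_eq]
    split_ifs <;> linarith
  linarith

end LocalAlgorithm

/-! ### From random decision trees to finitely many coin outcomes -/

section QueryTree

variable {Ξ : Type*} {n : ℕ}

/-- The set of indices that a decision tree reads on the word `w`. -/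
def QueryTree.queried : QueryTree Ξ n → (Fin n → Ξ) → Finset (Fin n)
  | .output _, _ => ∅
  | .query i next, w => insert i ((next (w i)).queried w)

theorem QueryTree.card_queried_le (T : QueryTree Ξ n) (w : Fin n → Ξ) :
    (T.queried w).card ≤ T.numQueries w := by
  induction T with
  | output b => simp [queried]
  | query i next ih => exact (card_insert_le _ _).trans (Nat.succ_le_succ (ih (w i)))

theorem QueryTree.congr (T : QueryTree Ξ n) (v w : Fin n → Ξ)
    (h : ∀ i ∈ T.queried v, v i = w i) : T.queried w = T.queried v ∧ T.run w = T.run v := by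
  induction T with
  | output b => exact ⟨rfl, rfl⟩
  | query i next ih =>
    have hi : v i = w i := h i (mem_insert_self _ _)
    have := ih (v i) fun x hx => h x (mem_insert_of_mem hx)
    simp only [queried, run, ← hi]
    exact ⟨by rw [this.1], this.2⟩

theorem PMF.map_congr_on_support {α β : Type*} (p : PMF α) {f g : α → β}
    (h : ∀ a ∈ p.support, f a = g a) : p.map f = p.map g := by
  classical
  ext b
  rw [PMF.map_apply, PMF.map_apply]
  refine tsum_congr fun a => ?_
  by_cases ha : a ∈ p.support
  · rw [h a ha]
  · rw [(PMF.apply_eq_zero_iff p a).2 ha]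
    simp

theorem PMF.sum_toReal {α : Type*} [Fintype α] (p : PMF α) : ∑ a, (p a).toReal = 1 := by
  rw [← ENNReal.toReal_sum fun a _ => p.apply_ne_top a, ← tsum_fintype (L := .unconditional α), p.tsum_coe,
    ENNReal.toReal_one]

theorem PMF.sum_map_toReal_mul {α β : Type*} [Fintype α] [Fintype β] (p : PMF α) (g : α → β)
    (f : β → ℝ) : ∑ b, ((p.map g) b).toReal * f b = ∑ a, (p a).toReal * f (g a) := by
  classical
  have : ∀ b, ((p.map g) b).toReal * f b
      = ∑ a, if b = g a then (p a).toReal * f (g a) else 0 := by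
    intro b
    rw [PMF.map_apply, tsum_fintype, ENNReal.toReal_sum, sum_mul]
    · refine sum_congr rfl fun a _ => ?_
      split_ifs with h <;> simp [h]
    · intro a _
      split_ifs <;> simp [p.apply_ne_top]
  simp_rw [this]
  rw [sum_comm]
  simp

/-- The possible behaviours of a deterministic algorithm that makes at most `q` queries. -/
def Behaviour (Ξ : Type*) (n q : ℕ) : Type _ :=
  {φ : (Fin n → Ξ) → Finset (Fin n) × Bool //
    (∀ w, (φ w).1.card ≤ q) ∧ ∀ v w, (∀ i ∈ (φ v).1, v i = w i) → φ w = φ v}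

/-- Trees of bounded depth on all words may still be infinitely many, since queries can be repeated
along unreachable branches. Passing to behaviours makes the coin space finite and the same for all
proofs. -/
instance [Fintype Ξ] (q : ℕ) : Fintype (Behaviour Ξ n q) := by
  classical
  unfold Behaviour
  infer_instance

open Classical in
/-- The behaviour of a decision tree of depth at most `q`. -/
def QueryTree.behaviour (q : ℕ) (T : QueryTree Ξ n) : Behaviour Ξ n q :=
  if h : ∀ w, T.numQueries w ≤ q then
    ⟨fun w => (T.queried w, T.run w), fun w => (T.card_queried_le w).trans (h w),
      fun v w hvw => Prod.ext (T.congr v w hvw).1 (T.congr v w hvw).2⟩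
  -- A junk value; it is never reached with positive probability for a verifier obeying its query
  -- bound.
  else ⟨fun _ => (∅, false), fun _ => by simp, fun _ _ _ => rfl⟩

/-- A random decision tree of depth at most `q` as a local algorithm. -/
def localAlgorithmOfTrees [Fintype Ξ] (q : ℕ) (D : PMF (QueryTree Ξ n)) :
    LocalAlgorithm (Behaviour Ξ n q) Ξ n where
  weight φ := ((D.map (QueryTree.behaviour q)) φ).toReal
  weight_nonneg φ := ENNReal.toReal_nonneg
  sum_weight := PMF.sum_toReal _
  queried φ w := (φ.1 w).1
  accepts φ w := (φ.1 w).2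
  queried_congr φ v w h := by rw [φ.2.2 v w h]
  accepts_congr φ v w h := by rw [φ.2.2 v w h]

theorem queriesAtMost_localAlgorithmOfTrees [Fintype Ξ] (q : ℕ) (D : PMF (QueryTree Ξ n)) :
    (localAlgorithmOfTrees q D).QueriesAtMost q := fun φ w => φ.2.1 w

theorem acceptProb_localAlgorithmOfTrees [Fintype Ξ] {q : ℕ} {D : PMF (QueryTree Ξ n)}
    (h : ∀ T ∈ D.support, ∀ w, T.numQueries w ≤ q) (w : Fin n → Ξ) :
    (localAlgorithmOfTrees q D).acceptProb w = treeAcceptProb D w := by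
  have h1 : D.map (fun T => T.run w)
      = (D.map (QueryTree.behaviour q)).map fun φ => (φ.1 w).2 := by
    rw [PMF.map_comp]
    refine PMF.map_congr_on_support D fun T hT => ?_
    simp [QueryTree.behaviour, h T hT]
  have h2 := PMF.sum_map_toReal_mul (D.map (QueryTree.behaviour q))
    (fun φ : Behaviour Ξ n q => (φ.1 w).2) (fun b => if b then 1 else 0)
  rw [← h1] at h2
  simp only [Fintype.sum_bool, if_true, mul_one, Bool.false_eq_true, if_false, mul_zero,
    add_zero] at h2
  rw [treeAcceptProb, h2]
  simp [LocalAlgorithm.acceptProb, localAlgorithmOfTrees]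

end QueryTree

/-! ### Non-adaptive tests from decision rules on a sample -/

section Rule

variable {Ξ : Type*} {n : ℕ}

open Classical in
/-- The non-adaptive algorithm that reads a random set of indices of density `ρ`, or
nothing if this set has more than `N` indices, and decides by the rule `R`. -/
def sampleAlgorithm (ρ : ℝ) (h0 : 0 ≤ ρ) (h1 : ρ ≤ 1) (N : ℕ)
    (R : Finset (Fin n) → (Fin n → Ξ) → Prop) : NonAdaptiveAlgorithm Ξ n where
  queryDist := (PMF.ofFintype (fun S : Finset (Fin n) => ENNReal.ofReal (subsetWeight ρ S)) (by
    rw [← ENNReal.ofReal_sum_of_nonneg fun S _ => subsetWeight_nonneg h0 h1 S,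
      sum_subsetWeight, ENNReal.ofReal_one])).map fun S => if S.card ≤ N then S else ∅
  -- The rule is stated for full words; when it depends only on the letters in `Q`, every extension
  -- of `u` gives the same answer.
  accept Q u := if ∃ w, (∀ i : Q, w i = u i) ∧ R Q w then 1 else 0

variable {ρ : ℝ} (h0 : 0 ≤ ρ) (h1 : ρ ≤ 1) {N : ℕ} {R : Finset (Fin n) → (Fin n → Ξ) → Prop}

theorem queriesAtMost_sampleAlgorithm : (sampleAlgorithm ρ h0 h1 N R).QueriesAtMost N := by
  intro Q hQ
  obtain ⟨S, -, rfl⟩ := (PMF.mem_support_map_iff _ _ _).1 hQ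
  split_ifs with h
  · exact h
  · simp

theorem acceptProb_sampleAlgorithm (hR : ∀ S v w, (∀ i ∈ S, v i = w i) → R S v → R S w)
    (w : Fin n → Ξ) : (sampleAlgorithm ρ h0 h1 N R).acceptProb w
      = subsetProb ρ fun S => R (if S.card ≤ N then S else ∅) w := by
  classical
  have hacc : ∀ Q : Finset (Fin n),
      (((sampleAlgorithm ρ h0 h1 N R).accept Q fun i => w i : Set.Icc (0 : ℝ) 1) : ℝ)
        = if R Q w then 1 else 0 := by
    intro Q
    have : (∃ v : Fin n → Ξ, (∀ i : Q, v i = w i) ∧ R Q v) ↔ R Q w :=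
      ⟨fun ⟨v, hv, hRv⟩ => hR Q v w (fun i hi => hv ⟨i, hi⟩) hRv, fun h => ⟨w, fun _ => rfl, h⟩⟩
    simp only [sampleAlgorithm, this]
    split_ifs <;> simp
  unfold NonAdaptiveAlgorithm.acceptProb
  simp_rw [hacc]
  simp only [sampleAlgorithm]
  rw [PMF.sum_map_toReal_mul]
  unfold subsetProb
  refine sum_congr rfl fun S _ => ?_
  rw [PMF.ofFintype_apply, ENNReal.toReal_ofReal (subsetWeight_nonneg h0 h1 S)]
  by_cases h : R (if S.card ≤ N then S else ∅) w <;> simp [h]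

theorem subsetProb_card_gt_le (h0 : 0 < ρ) (h1 : ρ ≤ 1) (hn : 0 < n)
    (hN : 20 * (n * ρ) ≤ N + 1) :
    subsetProb ρ (fun S : Finset (Fin n) => N < S.card) ≤ 1 / 20 := by
  have hpos : 0 < (n : ℝ) * ρ := by positivity
  have := subsetProb_markov (E := fun S : Finset (Fin n) => N < S.card)
    (f := fun S => (S.card : ℝ)) (b := 20 * (n * ρ)) (c := n * ρ) h0.le h1 (by positivity)
    (fun S => by positivity)
    (fun S hS => hN.trans (by exact_mod_cast hS)) (by simp [sum_subsetWeight_mul_card])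
  refine this.trans_eq ?_
  field_simp

/-- A decision rule that errs with probability at most `1/20` on a random sample yields a
non-adaptive test. -/
theorem exists_test_of_rule {L : Set (Fin n → Ξ)} {ε : ℝ} (h0 : 0 < ρ) (h1 : ρ ≤ 1)
    (hn : 0 < n) (hN : 20 * (n * ρ) ≤ N + 1)
    (hR : ∀ S v w, (∀ i ∈ S, v i = w i) → R S v → R S w)
    (hcomp : ∀ w ∈ L, subsetProb ρ (fun S => ¬ R S w) ≤ 1 / 20)
    (hsound : ∀ w, FarFrom ε w L → subsetProb ρ (fun S => R S w) ≤ 1 / 20) :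
    ∃ A : NonAdaptiveAlgorithm Ξ n, A.QueriesAtMost N ∧ A.IsTest ε (1 / 10) L := by
  have hcard := subsetProb_card_gt_le (N := N) h0 h1 hn hN
  refine ⟨sampleAlgorithm ρ h0.le h1 N R, queriesAtMost_sampleAlgorithm _ _, ?_, ?_⟩
  · intro w hw
    rw [acceptProb_sampleAlgorithm _ _ hR]
    have := (subsetProb_mono h0.le h1 (E := fun S => ¬ R (if S.card ≤ N then S else ∅) w)
      (F := fun S => ¬ R S w ∨ N < S.card) fun S hS => by
        by_cases h : S.card ≤ N
        · left; simpa [h] using hS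
        · exact Or.inr (not_le.1 h)).trans (subsetProb_or_le h0.le h1 _ _)
    rw [subsetProb_not] at this
    have := hcomp w hw
    linarith
  · intro w hw
    rw [acceptProb_sampleAlgorithm _ _ hR]
    have := (subsetProb_mono h0.le h1 (E := fun S => R (if S.card ≤ N then S else ∅) w)
      (F := fun S => R S w ∨ N < S.card) fun S hS => by
        by_cases h : S.card ≤ N
        · left; simpa [h] using hS
        · exact Or.inr (not_le.1 h)).trans (subsetProb_or_le h0.le h1 _ _)
    have := hsound w hw
    linarith

/-- Reading the whole word. -/
theorem exists_test_reading_all (L : Set (Fin n → Ξ)) {ε : ℝ} (hε : 0 ≤ ε) :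
    ∃ A : NonAdaptiveAlgorithm Ξ n, A.QueriesAtMost n ∧ A.IsTest ε (1 / 10) L := by
  classical
  refine ⟨⟨PMF.pure univ, fun Q u => if ∃ w ∈ L, ∀ i : Q, w i = u i then 1 else 0⟩, ?_, ?_⟩
  · intro Q hQ
    simpa using card_le_univ Q
  · have key : ∀ w : Fin n → Ξ, (⟨PMF.pure univ, fun Q u =>
        if ∃ w ∈ L, ∀ i : Q, w i = u i then 1 else 0⟩ : NonAdaptiveAlgorithm Ξ n).acceptProb w
        = if w ∈ L then 1 else 0 := by
      intro w
      unfold NonAdaptiveAlgorithm.acceptProb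
      rw [sum_eq_single univ]
      · have : (∃ v ∈ L, ∀ i : (univ : Finset (Fin n)), v i = w i) ↔ w ∈ L :=
          ⟨fun ⟨v, hv, h⟩ => (funext fun i => h ⟨i, mem_univ i⟩ : v = w) ▸ hv,
            fun h => ⟨w, h, fun _ => rfl⟩⟩
        simp only [this, PMF.pure_apply]
        split_ifs <;> simp
      · intro Q _ hQ
        simp [PMF.pure_apply, hQ]
      · simp
    constructor
    · intro w hw
      rw [key, if_pos hw]
      norm_num
    · intro w hw
      rw [key, if_neg]
      · norm_num
      · intro hL
        exact hw w hL ⟨∅, by simp; positivity, fun _ _ => rfl⟩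

end Rule

/-! ### Counting kernels; heavy indices and daisies -/

theorem card_filter_card_le {α : Type*} [Fintype α] [DecidableEq α] (s : ℕ) :
    (univ.filter fun K : Finset α => K.card ≤ s).card ≤ (Fintype.card α + 1) ^ s := by
  induction s with
  | zero => simp [filter_eq']
  | succ s ih =>
    have hsub : (univ.filter fun K : Finset α => K.card ≤ s + 1) ⊆
        image₂ (fun (o : Option α) K => o.elim K fun i => insert i K) univ
          (univ.filter fun K : Finset α => K.card ≤ s) := by
      intro K hK
      simp only [mem_filter, mem_univ, true_and] at hK
      rw [mem_image₂]
      rcases K.eq_empty_or_nonempty with rfl | ⟨i, hi⟩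
      · exact ⟨none, mem_univ _, ∅, by simp, rfl⟩
      · refine ⟨some i, mem_univ _, K.erase i, ?_, by simp [insert_erase hi]⟩
        simp only [mem_filter, mem_univ, true_and, card_erase_of_mem hi]
        omega
    refine (card_le_card hsub).trans ((card_image₂_le _ _ _).trans ?_)
    rw [card_univ, Fintype.card_option, pow_succ, mul_comm]
    exact Nat.mul_le_mul_right _ ih

namespace LocalAlgorithm

variable {Ω Ξ : Type*} [Fintype Ω] {n : ℕ} (A : LocalAlgorithm Ω Ξ n)

/-- The probability that the index `i` is read, on the word `v`. -/
def degree (v : Fin n → Ξ) (i : Fin n) : ℝ :=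
  ∑ ω, if i ∈ A.queried ω v then A.weight ω else 0

/-- The indices that are read with probability at least `θ`, on the word `v`. -/
def heavy (v : Fin n → Ξ) (θ : ℝ) : Finset (Fin n) :=
  open Classical in univ.filter fun i => θ ≤ A.degree v i

/-- The accepting outcomes that read exactly `j` indices outside `K`, none of which is
in `K'`. -/
def daisy (v : Fin n → Ξ) (K K' : Finset (Fin n)) (j : ℕ) : Finset Ω :=
  univ.filter fun ω => A.accepts ω v = true ∧ (A.queried ω v \ K).card = j ∧
    Disjoint (A.queried ω v \ K) K'

theorem heavy_anti (v : Fin n → Ξ) {θ θ' : ℝ} (h : θ ≤ θ') : A.heavy v θ' ⊆ A.heavy v θ := by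
  intro i hi
  simp only [heavy, mem_filter, mem_univ, true_and] at hi ⊢
  exact h.trans hi

variable {A}

/-- Double counting: the degrees add up to the expected number of indices read. -/
theorem QueriesAtMost.mul_card_heavy_le {N : ℕ} (h : A.QueriesAtMost N) (v : Fin n → Ξ)
    (θ : ℝ) : θ * (A.heavy v θ).card ≤ N := by
  have hdeg : ∀ i, 0 ≤ A.degree v i := fun i => sum_nonneg fun ω _ => by
    split_ifs <;> first | exact le_rfl | exact A.weight_nonneg ω
  calc θ * (A.heavy v θ).card = ∑ i ∈ A.heavy v θ, θ := by simp [mul_comm]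
    _ ≤ ∑ i ∈ A.heavy v θ, A.degree v i := by
        refine sum_le_sum fun i hi => ?_
        simpa [heavy] using hi
    _ ≤ ∑ i, A.degree v i := sum_le_sum_of_subset_of_nonneg (subset_univ _) fun i _ _ => hdeg i
    _ = ∑ ω, (A.queried ω v).card * A.weight ω := by
        unfold degree
        rw [sum_comm]
        refine sum_congr rfl fun ω _ => ?_
        simp
    _ ≤ ∑ ω, N * A.weight ω := by
        refine sum_le_sum fun ω _ => ?_
        have := h ω v
        have := A.weight_nonneg ω
        gcongr
    _ = N := by rw [← mul_sum, A.sum_weight, mul_one]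

/-- Petals avoid the heavy indices, which therefore have degree zero in the daisy; every other index
has degree below `θ` already in the whole algorithm. -/
theorem degreeLE_daisy (v : Fin n → Ξ) (K : Finset (Fin n)) {θ : ℝ} (hθ : 0 ≤ θ) (j : ℕ) :
    DegreeLE (A.daisy v K (A.heavy v θ) j) A.weight (fun ω => A.queried ω v \ K) θ := by
  intro i
  by_cases hi : i ∈ A.heavy v θ
  · refine (sum_eq_zero fun ω hω => ?_).trans_le hθ
    simp only [daisy, mem_filter] at hω
    exact if_neg fun hiP => disjoint_left.1 hω.2.2.2 hiP hi
  · have hlt : A.degree v i < θ := by simpa [heavy] using hi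
    refine le_trans ?_ hlt.le
    refine (sum_le_sum_of_subset_of_nonneg (subset_univ _) fun ω _ _ => ?_).trans
      (sum_le_sum fun ω _ => ?_)
    · split_ifs <;> first | exact le_rfl | exact A.weight_nonneg ω
    · have := A.weight_nonneg ω
      by_cases h1 : i ∈ A.queried ω v <;> by_cases h2 : i ∈ K <;> simp [h1, h2, this]

/-- Every accepting outcome belongs to the daisy of one of the levels. -/
theorem exists_mem_daisy {N : ℕ} (h : A.QueriesAtMost N) (v : Fin n → Ξ) {θ : ℕ → ℝ}
    (hθ : Monotone θ) {ω : Ω} (hω : A.accepts ω v = true) :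
    ∃ j ≤ N, ω ∈ A.daisy v (A.heavy v (θ j)) (A.heavy v (θ (j - 1))) j := by
  classical
  -- The level is the least such `j`. Minimality leaves at least `j` queries outside the larger
  -- kernel of level `j - 1`; they lie among the at most `j` queries outside the kernel of level
  -- `j`, so the two sets coincide. At `j = 0` all these sets are empty.
  have hex : ∃ j, (A.queried ω v \ A.heavy v (θ j)).card ≤ j :=
    ⟨N, (card_le_card sdiff_subset).trans (h ω v)⟩
  have hspec := Nat.find_spec hex
  set j := Nat.find hex with hj
  refine ⟨j, Nat.find_min' hex ((card_le_card sdiff_subset).trans (h ω v)), ?_⟩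
  simp only [daisy, mem_filter, mem_univ, true_and]
  refine ⟨hω, ?_⟩
  have hsub : A.queried ω v \ A.heavy v (θ (j - 1)) ⊆ A.queried ω v \ A.heavy v (θ j) :=
    sdiff_subset_sdiff subset_rfl (A.heavy_anti v (hθ (Nat.sub_le j 1)))
  have hle : j ≤ (A.queried ω v \ A.heavy v (θ (j - 1))).card := by
    rcases Nat.eq_zero_or_pos j with h0 | hpos
    · omega
    · have := Nat.find_min hex (m := j - 1) (by omega)
      omega
  have heq := eq_of_subset_of_card_le hsub (hspec.trans hle)
  refine ⟨le_antisymm hspec (hle.trans (card_le_card hsub)), ?_⟩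
  rw [← heq]
  exact sdiff_disjoint

/-- The daisy of some level has a large share of the accepting probability. -/
theorem exists_le_weight_daisy {N : ℕ} (h : A.QueriesAtMost N) (v : Fin n → Ξ) {θ : ℕ → ℝ}
    (hθ : Monotone θ) : ∃ j ≤ N, A.acceptProb v ≤
      (N + 1) * ∑ ω ∈ A.daisy v (A.heavy v (θ j)) (A.heavy v (θ (j - 1))) j, A.weight ω := by
  classical
  set D := fun j => A.daisy v (A.heavy v (θ j)) (A.heavy v (θ (j - 1))) j
  have hsum : A.acceptProb v ≤ ∑ j ∈ range (N + 1), ∑ ω ∈ D j, A.weight ω := by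
    have : ∀ j, ∑ ω ∈ D j, A.weight ω = ∑ ω, if ω ∈ D j then A.weight ω else 0 := by
      intro j; simp
    simp_rw [this]
    rw [sum_comm]
    refine sum_le_sum fun ω _ => ?_
    have hn : ∀ j ∈ range (N + 1), 0 ≤ if ω ∈ D j then A.weight ω else 0 := by
      intro j _
      split_ifs <;> first | exact le_rfl | exact A.weight_nonneg ω
    split_ifs with hω
    · obtain ⟨j, hj, hD⟩ := exists_mem_daisy h v hθ hω
      calc A.weight ω = if ω ∈ D j then A.weight ω else 0 := (if_pos hD).symm
        _ ≤ _ := single_le_sum hn (mem_range.2 (Nat.lt_succ_of_le hj))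
    · exact sum_nonneg hn
  by_contra! hcon
  have : ∑ j ∈ range (N + 1), ∑ ω ∈ D j, A.weight ω
      < ∑ j ∈ range (N + 1), A.acceptProb v / (N + 1) := by
    refine sum_lt_sum_of_nonempty (by simp) fun j hj => ?_
    rw [lt_div_iff₀ (by positivity), mul_comm]
    exact hcon j (Nat.lt_succ_iff.1 (mem_range.1 hj))
  have h2 : ∑ j ∈ range (N + 1), A.acceptProb v / (N + 1) = A.acceptProb v := by
    rw [sum_const, card_range, nsmul_eq_mul]
    push_cast
    field_simp
  linarith

end LocalAlgorithm

/-! ### The sample-based test and its error -/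

section Overwrite

variable {Ξ : Type*} {n : ℕ}

/-- The word `w`, overwritten by `u` on the set `K`. -/
def overwrite (w : Fin n → Ξ) (K : Finset (Fin n)) (u : K → Ξ) : Fin n → Ξ :=
  fun i => if h : i ∈ K then u ⟨i, h⟩ else w i

theorem FarFrom.overwrite {ε η : ℝ} {w : Fin n → Ξ} {L : Set (Fin n → Ξ)} (h : FarFrom ε w L)
    (K : Finset (Fin n)) (hK : (K.card : ℝ) ≤ (ε - η) * n) (u : K → Ξ) :
    FarFrom η (overwrite w K u) L := by
  classical
  rintro v hv ⟨B, hB, hagree⟩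
  refine h v hv ⟨B ∪ K, ?_, fun i hi => ?_⟩
  · have : ((B ∪ K).card : ℝ) ≤ B.card + K.card := by exact_mod_cast card_union_le B K
    linarith
  · simp only [mem_union, not_or] at hi
    rw [← hagree i hi.1, PropertyTesting.overwrite, dif_neg hi.2]

end Overwrite

section Core

variable {Ω Ψ Ξ : Type*} [Fintype Ω] [Fintype Ψ] [Fintype Ξ] {n : ℕ}

/-- The sample `S` of the word `w` is consistent with some word `v` that, for some proof `π`,
has a daisy with much weight in `S`. -/
def DaisyRule (A : Ψ → LocalAlgorithm Ω Ξ n) (N : ℕ) (θ t : ℕ → ℝ) (S : Finset (Fin n))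
    (w : Fin n → Ξ) : Prop :=
  ∃ π, ∃ j ≤ N, ∃ v : Fin n → Ξ, (∀ i ∈ S, v i = w i) ∧
    2 * t j ≤ weightInside
      ((A π).daisy v ((A π).heavy v (θ j)) ((A π).heavy v (θ (j - 1))) j) (A π).weight
      (fun ω => (A π).queried ω v \ (A π).heavy v (θ j)) S

/-- The outcomes that accept `w` and read exactly `j` indices outside `K`. -/
def LocalAlgorithm.petals (A : LocalAlgorithm Ω Ξ n) (w : Fin n → Ξ) (K : Finset (Fin n))
    (j : ℕ) : Finset Ω :=
  univ.filter fun ω => A.accepts ω w = true ∧ (A.queried ω w \ K).card = j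

omit [Fintype Ξ] in
theorem LocalAlgorithm.sum_petals_le (A : LocalAlgorithm Ω Ξ n) (w : Fin n → Ξ)
    (K : Finset (Fin n)) (j : ℕ) : ∑ ω ∈ A.petals w K j, A.weight ω ≤ A.acceptProb w := by
  rw [acceptProb, ← sum_filter]
  refine sum_le_sum_of_subset_of_nonneg (fun ω hω => ?_) fun ω _ _ => A.weight_nonneg ω
  simp only [petals, mem_filter] at hω ⊢
  exact ⟨hω.1, hω.2.1⟩

omit [Fintype Ξ] in
-- A run on `v` whose petal lies in `S` reads only kernel letters, copied from `v`, and sampled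
-- letters, shared by `v` and `w`. It therefore proceeds identically on the overwritten word, which
-- depends on `v` only through its letters on `K`; this is what makes the union bound affordable.
theorem exists_subfamily_of_agree {A : LocalAlgorithm Ω Ξ n} {v w : Fin n → Ξ}
    {S K : Finset (Fin n)} {θ b : ℝ} (hθ : 0 ≤ θ) {j : ℕ} (hvw : ∀ i ∈ S, v i = w i)
    (hb : b ≤ weightInside (A.daisy v K (A.heavy v θ) j) A.weight
      (fun ω => A.queried ω v \ K) S) :
    ∃ B' ⊆ A.petals (overwrite w K fun i => v i) K j,
      DegreeLE B' A.weight (fun ω => A.queried ω (overwrite w K fun i => v i) \ K) θ ∧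
      b ≤ weightInside B' A.weight
        (fun ω => A.queried ω (overwrite w K fun i => v i) \ K) S := by
  classical
  set w' := overwrite w K fun i => v i
  set D := A.daisy v K (A.heavy v θ) j
  have hagree : ∀ ω, A.queried ω v \ K ⊆ S → ∀ i ∈ A.queried ω v, v i = w' i := by
    intro ω hω i hi
    by_cases hiK : i ∈ K
    · simp [w', overwrite, hiK]
    · simp only [w', overwrite, hiK, dite_false]
      exact hvw i (hω (mem_sdiff.2 ⟨hi, hiK⟩))
  have hq : ∀ ω, A.queried ω v \ K ⊆ S → A.queried ω w' = A.queried ω v := fun ω hω =>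
    A.queried_congr ω v w' (hagree ω hω)
  refine ⟨D.filter fun ω => A.queried ω v \ K ⊆ S, ?_, ?_, ?_⟩
  · intro ω hω
    obtain ⟨hD, hS⟩ := mem_filter.1 hω
    simp only [D, LocalAlgorithm.daisy, mem_filter, mem_univ, true_and] at hD
    simp only [LocalAlgorithm.petals, mem_filter, mem_univ, true_and]
    rw [hq ω hS, A.accepts_congr ω v w' (hagree ω hS)]
    exact ⟨hD.1, hD.2.1⟩
  · intro i
    refine le_trans ?_ (A.degreeLE_daisy v K hθ j i)
    rw [sum_filter]
    refine sum_le_sum fun ω _ => ?_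
    have := A.weight_nonneg ω
    by_cases hS : A.queried ω v \ K ⊆ S
    · simp only [if_pos hS, hq ω hS, le_refl]
    · rw [if_neg hS]
      split_ifs <;> first | exact le_rfl | exact this
  · refine hb.trans_eq ?_
    unfold weightInside
    rw [sum_filter]
    refine sum_congr rfl fun ω _ => ?_
    by_cases hS : A.queried ω v \ K ⊆ S
    · simp only [if_pos hS, hq ω hS]
    · rw [if_neg hS, if_neg hS]

variable {A : Ψ → LocalAlgorithm Ω Ξ n} {N : ℕ} {θ : ℕ → ℝ} {ρ a δ : ℝ}

omit [Fintype Ψ] [Fintype Ξ] in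
-- The word `w` itself is the witness: its best daisy weighs at least `4 * a`, and half of its
-- expected weight in `S` already reaches `2 * a * ρ ^ j`.
theorem subsetProb_not_daisyRule_le (hN : ∀ π, (A π).QueriesAtMost N) (hθ : Monotone θ)
    (hθ0 : ∀ j, 0 ≤ θ j) (h0 : 0 < ρ) (h1 : ρ ≤ 1) (ha : 0 < a)
    (hlow : ∀ j ≤ N, j * θ (j - 1) ≤ a * ρ ^ j / 20) {w : Fin n → Ξ} {π : Ψ}
    (hw : 4 * a * (N + 1) ≤ (A π).acceptProb w) :
    subsetProb ρ (fun S => ¬ DaisyRule A N θ (fun j => a * ρ ^ j) S w) ≤ 1 / 20 := by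
  obtain ⟨j, hj, hD⟩ := LocalAlgorithm.exists_le_weight_daisy (hN π) w hθ
  set D := (A π).daisy w ((A π).heavy w (θ j)) ((A π).heavy w (θ (j - 1))) j
  set M := ∑ ω ∈ D, (A π).weight ω
  have hM : 4 * a ≤ M := by
    have : 4 * a * (N + 1) ≤ M * (N + 1) := by linarith
    exact le_of_mul_le_mul_right this (by positivity)
  have hM0 : 0 < M := by linarith
  have hρ : 0 < ρ ^ j := pow_pos h0 j
  have hcard : ∀ ω ∈ D, ((A π).queried ω w \ (A π).heavy w (θ j)).card = j := by
    intro ω hω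
    simp only [D, LocalAlgorithm.daisy, mem_filter] at hω
    exact hω.2.2.1
  have htail := subsetProb_lower_tail (A π).weight_nonneg h0 h1 hcard
    (LocalAlgorithm.degreeLE_daisy w _ (hθ0 (j - 1)) j) hM0
  refine le_trans (subsetProb_mono h0.le h1 fun S hS => ?_) (htail.trans ?_)
  · contrapose! hS
    refine ⟨π, j, hj, w, fun _ _ => rfl, le_trans ?_ hS⟩
    have := mul_le_mul_of_nonneg_right hM hρ.le
    linarith
  · rw [div_le_iff₀ (by positivity)]
    have := mul_le_mul_of_nonneg_right hM hρ.le
    have := hlow j hj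
    change 4 * (j : ℝ) * θ (j - 1) ≤ 1 / 20 * (M * ρ ^ j)
    linarith

/-- The slack `ε - η` pays for overwriting a kernel, after which soundness bounds the accepting
weight by `δ ≤ a / 2`. Each choice of proof, level, kernel and kernel letters then fails with
probability at most `2 ^ (-m j)`. -/
theorem subsetProb_daisyRule_le {s m : ℕ → ℕ} (hN : ∀ π, (A π).QueriesAtMost N)
    (hθ0 : ∀ j, 0 < θ j) (h0 : 0 < ρ) (h1 : ρ ≤ 1) (ha : 0 < a) (hδ : 2 * δ ≤ a)
    {L : Set (Fin n → Ξ)} {ε η : ℝ}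
    (hs : ∀ j ≤ N, N < θ j * (s j + 1)) (hsε : ∀ j ≤ N, (s j : ℝ) ≤ (ε - η) * n)
    (hm : ∀ j ≤ N, m j * j * θ (j - 1) ≤ a * ρ ^ j)
    (hunion : ∀ j ≤ N, 20 * (N + 1) * (Fintype.card Ψ * ((n + 1) * Fintype.card Ξ) ^ s j : ℝ)
      ≤ 2 ^ m j)
    (hsound : ∀ w, FarFrom η w L → ∀ π, (A π).acceptProb w ≤ δ)
    {w : Fin n → Ξ} (hw : FarFrom ε w L) (hΞ : 1 ≤ Fintype.card Ξ) :
    subsetProb ρ (fun S => DaisyRule A N θ (fun j => a * ρ ^ j) S w) ≤ 1 / 20 := by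
  classical
  set E : Ψ → ℕ → (K : Finset (Fin n)) → (K → Ξ) → Finset (Fin n) → Prop :=
    fun π j K u S => ∃ B' ⊆ (A π).petals (overwrite w K u) K j,
      DegreeLE B' (A π).weight (fun ω => (A π).queried ω (overwrite w K u) \ K) (θ (j - 1)) ∧
      2 * (a * ρ ^ j) ≤ weightInside B' (A π).weight
        (fun ω => (A π).queried ω (overwrite w K u) \ K) S
  set F : ℕ → Finset (Finset (Fin n)) := fun j => univ.filter fun K => K.card ≤ s j
  have hE : ∀ j ≤ N, ∀ π, ∀ K ∈ F j, ∀ u, subsetProb ρ (E π j K u) ≤ (1 / 2) ^ m j := by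
    intro j hj π K hK u
    have hρ : 0 < ρ ^ j := pow_pos h0 j
    have hKs : (K.card : ℝ) ≤ (ε - η) * n := by
      refine le_trans ?_ (hsε j hj)
      exact_mod_cast (mem_filter.1 hK).2
    have hM := ((A π).sum_petals_le (overwrite w K u) K j).trans
      (hsound _ (hw.overwrite K hKs u) π)
    have hM0 : 0 ≤ ∑ ω ∈ (A π).petals (overwrite w K u) K j, (A π).weight ω :=
      sum_nonneg fun ω _ => (A π).weight_nonneg ω
    refine (subsetProb_upper_tail (A π).weight_nonneg h0.le h1 (fun ω hω => ?_)
      (hθ0 (j - 1)).le (by positivity) (hm j hj)).trans ?_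
    · simp only [LocalAlgorithm.petals, mem_filter] at hω
      exact hω.2.2
    · refine pow_le_pow_left₀ (by positivity) ?_ _
      rw [mul_div_mul_right _ _ hρ.ne', div_le_iff₀ ha]
      linarith
  have hcover : ∀ S, DaisyRule A N θ (fun j => a * ρ ^ j) S w →
      ∃ π ∈ (univ : Finset Ψ), ∃ j ∈ range (N + 1), ∃ K ∈ F j, ∃ u ∈ (univ : Finset (K → Ξ)),
        E π j K u S := by
    rintro S ⟨π, j, hj, v, hvw, hge⟩
    refine ⟨π, mem_univ π, j, mem_range.2 (Nat.lt_succ_of_le hj), (A π).heavy v (θ j), ?_,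
      fun i => v i, mem_univ _, exists_subfamily_of_agree (hθ0 (j - 1)).le hvw hge⟩
    simp only [F, mem_filter, mem_univ, true_and]
    have h2 := ((hN π).mul_card_heavy_le v (θ j)).trans_lt (hs j hj)
    have h3 := lt_of_mul_lt_mul_left h2 (hθ0 j).le
    exact Nat.lt_succ_iff.1 (by exact_mod_cast h3)
  have hk : (1 : ℝ) ≤ Fintype.card Ξ := by exact_mod_cast hΞ
  have hlevel : ∀ j ∈ range (N + 1), ∀ π,
      subsetProb ρ (fun S => ∃ K ∈ F j, ∃ u ∈ (univ : Finset (K → Ξ)), E π j K u S)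
        ≤ ((n + 1) * Fintype.card Ξ) ^ s j * (1 / 2) ^ m j := by
    intro j hj π
    have hj' := Nat.lt_succ_iff.1 (mem_range.1 hj)
    calc _ ≤ ∑ K ∈ F j, ∑ u : K → Ξ, subsetProb ρ (E π j K u) :=
          (subsetProb_exists_le h0.le h1 _ _).trans
            (sum_le_sum fun K _ => subsetProb_exists_le h0.le h1 _ _)
      _ ≤ ∑ K ∈ F j, (Fintype.card Ξ : ℝ) ^ s j * (1 / 2) ^ m j := by
          refine sum_le_sum fun K hK => ?_
          refine (sum_le_sum fun u _ => hE j hj' π K hK u).trans ?_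
          rw [sum_const, card_univ, nsmul_eq_mul, Fintype.card_fun, Fintype.card_coe]
          push_cast
          gcongr ?_ * _
          exact pow_le_pow_right₀ hk (mem_filter.1 hK).2
      _ ≤ (n + 1 : ℝ) ^ s j * ((Fintype.card Ξ : ℝ) ^ s j * (1 / 2) ^ m j) := by
          rw [sum_const, nsmul_eq_mul]
          gcongr
          have := card_filter_card_le (α := Fin n) (s j)
          rw [Fintype.card_fin] at this
          exact_mod_cast this
      _ = _ := by rw [mul_pow]; ring
  calc _ ≤ ∑ π : Ψ, ∑ j ∈ range (N + 1),
        subsetProb ρ (fun S => ∃ K ∈ F j, ∃ u ∈ (univ : Finset (K → Ξ)), E π j K u S) :=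
        (subsetProb_mono h0.le h1 hcover).trans ((subsetProb_exists_le h0.le h1 _ _).trans
          (sum_le_sum fun π _ => subsetProb_exists_le h0.le h1 _ _))
    _ ≤ ∑ π : Ψ, ∑ j ∈ range (N + 1),
        ((n + 1) * Fintype.card Ξ : ℝ) ^ s j * (1 / 2) ^ m j :=
        sum_le_sum fun π _ => sum_le_sum fun j hj => hlevel j hj π
    _ = ∑ j ∈ range (N + 1),
        Fintype.card Ψ * ((n + 1) * Fintype.card Ξ : ℝ) ^ s j * (1 / 2) ^ m j := by
        rw [sum_const, card_univ, nsmul_eq_mul, mul_sum]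
        exact sum_congr rfl fun j _ => by ring
    _ ≤ ∑ j ∈ range (N + 1), 1 / (20 * (N + 1) : ℝ) := by
        refine sum_le_sum fun j hj => ?_
        have := hunion j (Nat.lt_succ_iff.1 (mem_range.1 hj))
        rw [one_div_pow, mul_one_div, div_le_div_iff₀ (by positivity) (by positivity)]
        linarith
    _ = 1 / 20 := by
        rw [sum_const, card_range, nsmul_eq_mul]
        push_cast
        field_simp

/-- A family of local algorithms, one for each proof, yields a non-adaptive test. -/
theorem exists_test_of_localAlgorithms {s m : ℕ → ℕ} (hN : ∀ π, (A π).QueriesAtMost N)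
    (hθ : Monotone θ) (hθ0 : ∀ j, 0 < θ j) (h0 : 0 < ρ) (h1 : ρ ≤ 1) (ha : 0 < a)
    (hδ : 2 * δ ≤ a) (haδ : 4 * a * (N + 1) ≤ 1 - δ) {L : Set (Fin n → Ξ)} {ε η : ℝ}
    (hs : ∀ j ≤ N, N < θ j * (s j + 1)) (hsε : ∀ j ≤ N, (s j : ℝ) ≤ (ε - η) * n)
    (hlow : ∀ j ≤ N, j * θ (j - 1) ≤ a * ρ ^ j / 20)
    (hm : ∀ j ≤ N, m j * j * θ (j - 1) ≤ a * ρ ^ j)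
    (hunion : ∀ j ≤ N, 20 * (N + 1) * (Fintype.card Ψ * ((n + 1) * Fintype.card Ξ) ^ s j : ℝ)
      ≤ 2 ^ m j)
    (hcomp : ∀ w ∈ L, ∃ π, 1 - δ ≤ (A π).acceptProb w)
    (hsound : ∀ w, FarFrom η w L → ∀ π, (A π).acceptProb w ≤ δ)
    (hΞ : 1 ≤ Fintype.card Ξ) (hn : 0 < n) {N' : ℕ} (hN' : 20 * (n * ρ) ≤ N' + 1) :
    ∃ T : NonAdaptiveAlgorithm Ξ n, T.QueriesAtMost N' ∧ T.IsTest ε (1 / 10) L := by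
  refine exists_test_of_rule (R := DaisyRule A N θ fun j => a * ρ ^ j) h0 h1 hn hN' ?_ ?_ ?_
  · rintro S v w hvw ⟨π, j, hj, v', hv', h⟩
    exact ⟨π, j, hj, v', fun i hi => (hv' i hi).trans (hvw i hi), h⟩
  · intro w hw
    obtain ⟨π, hπ⟩ := hcomp w hw
    exact subsetProb_not_daisyRule_le hN hθ (fun j => (hθ0 j).le) h0 h1 ha hlow
      (haδ.trans hπ)
  · intro w hw
    exact subsetProb_daisyRule_le hN hθ0 h0 h1 ha hδ hs hsε hm hunion hsound hw hΞ

end Core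

/-! ### Numerical estimates -/

section Parameters

/-- If `n` exceeds the bound of the theorem, then `x = n ^ (1 / q)` exceeds `2 * Q / ε` and the
number `8 * Q * (Q + 1) * W` that governs the union bound. -/
theorem root_bounds {Q n : ℕ} {q ε l : ℝ} (hq : 720 ≤ q) (hQ : (Q : ℝ) + 1 ≤ q / 2)
    (hε : 0 < ε) (hε1 : ε ≤ 1) (hl : 1 ≤ l) (hn : (24 * q ^ 10 * l ^ 2 / ε) ^ q < (n : ℝ)) :
    2 * Q / ε ≤ (n : ℝ) ^ q⁻¹ ∧ 160 * Q * (Q + 1) ≤ (n : ℝ) ^ q⁻¹ ∧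
    8 * Q * (Q + 1) * (1 + 20 * (Q + 1) + l + Q * (Real.logb 2 (n + 1) + l))
      ≤ (n : ℝ) ^ q⁻¹ := by
  have hq0 : 0 < q := by linarith
  have hQ0 : (0 : ℝ) ≤ Q := Nat.cast_nonneg Q
  have hx := (Real.lt_rpow_inv_iff_of_pos (by positivity) (Nat.cast_nonneg n) hq0).2 hn
  have hn1 : (1 : ℝ) ≤ n := by
    have : (0 : ℝ) < n := lt_of_le_of_lt (by positivity) hn
    exact_mod_cast this
  have hlog : Real.logb 2 n = q * Real.logb 2 ((n : ℝ) ^ q⁻¹) := by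
    rw [Real.logb_rpow_eq_mul_logb_of_pos (by linarith)]
    field_simp
  set x := (n : ℝ) ^ q⁻¹
  have hx0 : 0 < x := by positivity
  have hbig : 24 * q ^ 10 * l ^ 2 ≤ 24 * q ^ 10 * l ^ 2 / ε := by
    rw [le_div_iff₀ hε]
    exact mul_le_of_le_one_right (by positivity) hε1
  have hxb : 24 * q ^ 10 * l ^ 2 ≤ x := by linarith
  have hl2 : 1 ≤ l ^ 2 := one_le_pow₀ hl
  have hQQ : Q * (Q + 1) ≤ q ^ 2 / 4 := by nlinarith
  -- One factor `√x` absorbs the logarithm of `n`, the other the polynomial in `q`.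
  set z := Real.sqrt x
  have hzz : z ^ 2 = x := Real.sq_sqrt hx0.le
  have hz0 : 0 ≤ z := Real.sqrt_nonneg x
  have hz : 4 * q ^ 5 * l ≤ z := by
    apply Real.le_sqrt_of_sq_le
    refine le_trans ?_ hxb
    have : 0 ≤ q ^ 10 * l ^ 2 := by positivity
    nlinarith
  have hlogx : Real.logb 2 x ≤ 4 * z := by
    have h1 : Real.log x ≤ 2 * z := by
      have hz1 : 0 < z := Real.sqrt_pos.2 hx0
      have := Real.log_le_sub_one_of_pos hz1
      rw [← hzz, Real.log_pow]
      push_cast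
      linarith
    rw [Real.logb, div_le_iff₀ (Real.log_pos one_lt_two)]
    have := Real.log_two_gt_d9
    nlinarith
  have hlogn : Real.logb 2 (n + 1) ≤ 1 + 4 * q * z := by
    calc Real.logb 2 ((n : ℝ) + 1) ≤ Real.logb 2 (2 * n) :=
          Real.logb_le_logb_of_le one_lt_two (by positivity) (by linarith)
      _ = 1 + Real.logb 2 n := by
          rw [Real.logb_mul (by norm_num) (by linarith), Real.logb_self_eq_one one_lt_two]
      _ ≤ 1 + 4 * q * z := by
          rw [hlog]
          nlinarith
  refine ⟨?_, ?_, ?_⟩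
  · refine le_trans (div_le_div_of_nonneg_right ?_ hε.le) hx.le
    have : q ≤ q ^ 10 := le_self_pow₀ (by linarith) (by norm_num)
    nlinarith [mul_le_mul this hl2 (by norm_num) (by positivity)]
  · refine le_trans ?_ hxb
    have : q ^ 2 ≤ q ^ 10 := pow_le_pow_right₀ (by linarith) (by norm_num)
    have h2 : 40 * q ^ 2 ≤ q ^ 10 := by
      calc 40 * q ^ 2 ≤ q * q ^ 2 := by gcongr; linarith
        _ = q ^ 3 := by ring
        _ ≤ q ^ 10 := pow_le_pow_right₀ (by linarith) (by norm_num)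
    nlinarith [mul_le_mul h2 hl2 (by norm_num) (by positivity)]
  · have hW : 1 + 20 * ((Q : ℝ) + 1) + l + Q * (Real.logb 2 (n + 1) + l) ≤ 3 * q ^ 2 * z := by
      have h1 : Q * (Real.logb 2 (n + 1) + l) ≤ q / 2 * (1 + 4 * q * z + l) := by
        have : (Q : ℝ) ≤ q / 2 := by linarith
        calc Q * (Real.logb 2 (n + 1) + l) ≤ Q * (1 + 4 * q * z + l) := by gcongr
          _ ≤ _ := by gcongr
      have h2 : 13 * (q * l) ≤ q ^ 2 * z := by
        calc 13 * (q * l) ≤ (4 * q ^ 6) * (q * l) := by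
              gcongr
              have : 1 ≤ q ^ 5 := one_le_pow₀ (by linarith)
              nlinarith
          _ = q ^ 2 * (4 * q ^ 5 * l) := by ring
          _ ≤ q ^ 2 * z := by gcongr
      have h3 : q ≤ q * l := le_mul_of_one_le_right hq0.le hl
      have h4 : l ≤ q * l := le_mul_of_one_le_left (by linarith) (by linarith)
      nlinarith
    have h6 : 6 * q ^ 4 ≤ z := by
      refine le_trans ?_ hz
      have : 0 < q ^ 4 := by positivity
      have e : 4 * q ^ 5 * l = q ^ 4 * (4 * (q * l)) := by ring
      rw [e, mul_comm]
      gcongr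
      nlinarith
    calc 8 * Q * (Q + 1) * (1 + 20 * ((Q : ℝ) + 1) + l + Q * (Real.logb 2 (n + 1) + l))
        ≤ 2 * q ^ 2 * (3 * q ^ 2 * z) := by
          have : 8 * (Q : ℝ) * (Q + 1) ≤ 2 * q ^ 2 := by linarith
          have h0 : 0 ≤ Real.logb 2 (n + 1) := Real.logb_nonneg one_lt_two (by linarith)
          gcongr
      _ = 6 * q ^ 4 * z := by ring
      _ ≤ z * z := by gcongr
      _ = x := by rw [← hzz]; ring

/-- The number of events in the union bound for one level, in terms of the degree threshold
`t` of the level. -/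
theorem union_count_le {Q n p k s m : ℕ} {t l : ℝ} (ht : 0 < t) (hk : 2 ≤ k)
    (hl : l = Real.logb 2 k) (hpt : max (p : ℝ) 1 * t ≤ 1) (hs : (s : ℝ) ≤ Q / t)
    (hm : (1 + 20 * (Q + 1) + l + Q * (Real.logb 2 (n + 1) + l)) / t ≤ m + 1) :
    20 * (Q + 1) * (((k ^ p : ℕ) : ℝ) * ((n + 1) * k) ^ s) ≤ 2 ^ m := by
  have hk0 : (0 : ℝ) < k := by positivity
  have hl0 : 0 ≤ l := by
    rw [hl]
    exact Real.logb_nonneg one_lt_two (by exact_mod_cast (by omega : 1 ≤ k))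
  have hp1 : 1 * t ≤ 1 := (mul_le_mul_of_nonneg_right (le_max_right _ _) ht.le).trans hpt
  have hp2 : (p : ℝ) * t ≤ 1 :=
    (mul_le_mul_of_nonneg_right (le_max_left _ _) ht.le).trans hpt
  have hlogn : 0 ≤ Real.logb 2 ((n : ℝ) + 1) :=
    Real.logb_nonneg one_lt_two (by linarith [Nat.cast_nonneg (α := ℝ) n])
  have h20 : Real.logb 2 (20 * ((Q : ℝ) + 1)) ≤ 20 * (Q + 1) := by
    rw [Real.logb_le_iff_le_rpow one_lt_two (by positivity)]
    have := (Nat.lt_two_pow_self (n := 20 * (Q + 1))).le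
    have h2 : ((20 * (Q + 1) : ℕ) : ℝ) ≤ 2 ^ (20 * (Q + 1)) := by exact_mod_cast this
    rw [← Real.rpow_natCast] at h2
    push_cast at h2
    exact h2
  have hC0 : 0 < 20 * ((Q : ℝ) + 1) := by positivity
  have hC1 : 0 ≤ Real.logb 2 (20 * ((Q : ℝ) + 1)) :=
    Real.logb_nonneg one_lt_two (by linarith [Nat.cast_nonneg (α := ℝ) Q])
  generalize 20 * ((Q : ℝ) + 1) = C at *
  rw [← Real.rpow_natCast 2 m, ← Real.logb_le_iff_le_rpow one_lt_two (by positivity),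
    Real.logb_mul (by positivity) (by positivity), Nat.cast_pow,
    Real.logb_mul (by positivity) (by positivity), Real.logb_pow, Real.logb_pow,
    Real.logb_mul (by positivity) (by positivity), ← hl]
  rw [div_le_iff₀ ht] at hm
  rw [le_div_iff₀ ht] at hs
  have e1 : s * t * (Real.logb 2 (n + 1) + l) ≤ Q * (Real.logb 2 (n + 1) + l) := by gcongr
  have e2 : p * t * l ≤ 1 * l := by gcongr
  have e3 : t * Real.logb 2 C ≤ 1 * C := by
    gcongr
    linarith
  refine le_of_mul_le_mul_right ?_ ht
  linarith

/-- The error probability of `150 * l` repetitions is small compared to the inverse of the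
number of their queries. -/
theorem error_le (l q' : ℕ) (hl : 1 ≤ l) (hq : q' ≤ 2 ^ l) :
    2 * (8 / 9 : ℝ) ^ (75 * l) ≤ 1 / (8 * (((2 * (75 * l) * q' : ℕ) : ℝ) + 1)) := by
  -- Of the factor `6000 ^ l` gained, `4 ^ l` covers `2 * l * q'` and `1500 ^ l` covers the
  -- constants.
  have h1 : (8 / 9 : ℝ) ^ 75 ≤ 1 / 6000 := by norm_num
  have h2 : 2 * (l : ℝ) ≤ 2 ^ l := by
    obtain ⟨i, rfl⟩ := Nat.exists_eq_add_of_le' hl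
    have : i + 1 ≤ 2 ^ i := Nat.lt_two_pow_self
    rw [pow_succ, mul_comm]
    gcongr
    exact_mod_cast this
  have h3 : (q' : ℝ) ≤ 2 ^ l := by exact_mod_cast hq
  have h5 : 16 * (((2 * (75 * l) * q' : ℕ) : ℝ) + 1) ≤ 6000 ^ l := by
    push_cast
    have h6 : 2 * (l : ℝ) * q' ≤ 2 ^ l * 2 ^ l := by gcongr
    have h7 : (1500 : ℝ) * 4 ^ l * 4 ≤ 6000 ^ l * 4 := by
      have : (6000 : ℝ) ^ l = 1500 ^ l * 4 ^ l := by rw [← mul_pow]; norm_num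
      rw [this]
      have : (1500 : ℝ) ≤ 1500 ^ l := le_self_pow₀ (by norm_num) (by omega)
      gcongr
    have h8 : (2 : ℝ) ^ l * 2 ^ l = 4 ^ l := by rw [← mul_pow]; norm_num
    have h9 : (4 : ℝ) ≤ 4 ^ l := le_self_pow₀ (by norm_num) (by omega)
    rw [h8] at h6
    linarith
  calc 2 * (8 / 9 : ℝ) ^ (75 * l) = 2 * ((8 / 9 : ℝ) ^ 75) ^ l := by rw [pow_mul]
    _ ≤ 2 * (1 / 6000) ^ l := by gcongr
    _ ≤ _ := by
      rw [one_div_pow, mul_one_div, div_le_div_iff₀ (by positivity) (by positivity)]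
      linarith

end Parameters

/-! ### Choice of parameters and the test obtained from a MAP -/

section Main

variable {Ω Ψ Ξ : Type*} [Fintype Ω] [Fintype Ψ] [Fintype Ξ] {n : ℕ}

/-- The sample-based test, for a proof length less than `n ^ (1 / q ^ 2)`. -/
theorem exists_sample_test {A : Ψ → LocalAlgorithm Ω Ξ n} {Q p : ℕ} {q ε δ : ℝ}
    (hA : ∀ π, (A π).QueriesAtMost Q) (hQ1 : 1 ≤ Q) (hq : 720 ≤ q)
    (hQ : (Q : ℝ) + 1 ≤ q / 2) (hδ : 2 * δ ≤ 1 / (8 * ((Q : ℝ) + 1))) (hε : 0 < ε)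
    (hε1 : ε ≤ 1) (hΞ : 2 ≤ Fintype.card Ξ) (hΨ : Fintype.card Ψ = Fintype.card Ξ ^ p)
    (hn : (24 * q ^ 10 * (Real.logb 2 (Fintype.card Ξ)) ^ 2 / ε) ^ q < (n : ℝ))
    (hp : max (p : ℝ) 1 ≤ (n : ℝ) ^ (q ^ 2)⁻¹) {L : Set (Fin n → Ξ)}
    (hcomp : ∀ w ∈ L, ∃ π, 1 - δ ≤ (A π).acceptProb w)
    (hsound : ∀ w, FarFrom (ε / 2) w L → ∀ π, (A π).acceptProb w ≤ δ) :
    ∃ (N : ℕ) (T : NonAdaptiveAlgorithm Ξ n), (N : ℝ) ≤ 20 * (n : ℝ) ^ (1 - (q ^ 2)⁻¹) ∧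
      T.QueriesAtMost N ∧ T.IsTest ε (1 / 10) L := by
  set k := Fintype.card Ξ
  set l := Real.logb 2 k with hl
  have hl1 : 1 ≤ l := by
    rw [hl, Real.le_logb_iff_rpow_le one_lt_two (by positivity), Real.rpow_one]
    exact_mod_cast hΞ
  obtain ⟨hx1, hx2, hx3⟩ := root_bounds hq hQ hε hε1 hl1 hn
  have hq0 : 0 < q := by linarith
  have hn0 : (0 : ℝ) < n := lt_of_le_of_lt (by positivity) hn
  have hn1 : (1 : ℝ) ≤ n := by exact_mod_cast hn0
  have hQ0 : (1 : ℝ) ≤ Q := by exact_mod_cast hQ1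
  set x := (n : ℝ) ^ q⁻¹ with hx
  have hx_one : 1 ≤ x := Real.one_le_rpow hn1 (by positivity)
  set ρ := (n : ℝ) ^ (-(q ^ 2)⁻¹) with hρ
  have h0 : 0 < ρ := by positivity
  have h1 : ρ ≤ 1 := Real.rpow_le_one_of_one_le_of_nonpos hn1 (by simp; positivity)
  set a := 1 / (8 * ((Q : ℝ) + 1)) with ha
  have ha0 : 0 < a := by positivity
  -- The ratio of consecutive thresholds. The factor `1 / ρ ^ Q` compensates for the chance `ρ ^ j`
  -- of sampling a petal at any level `j ≤ Q`; the factor `x` is left for concentration and the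
  -- union bound.
  set y := x / ρ ^ Q with hy
  have hρQ : 0 < ρ ^ Q := by positivity
  have hy1 : 1 ≤ y := by
    rw [hy, le_div_iff₀ hρQ]
    exact (mul_le_one₀ le_rfl hρQ.le (pow_le_one₀ h0.le h1)).trans hx_one
  -- The starting value makes `Q / θ 0 = ε * n / 2`, so even the largest kernel may be overwritten
  -- at the cost of half the distance.
  set θ : ℕ → ℝ := fun j => 2 * Q / (ε * n) * y ^ j with hθ
  have hθ0 : ∀ j, 0 < θ j := fun j => by positivity
  have hmono : Monotone θ := fun i j hij =>
    mul_le_mul_of_nonneg_left (pow_le_pow_right₀ hy1 hij) (by positivity)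
  -- the last threshold is at most `1 / max p 1`
  have hlast : max (p : ℝ) 1 * θ Q ≤ 1 := by
    have e1 : θ Q = 2 * Q / ε * (x ^ Q / (ρ ^ Q) ^ Q) / n := by
      simp only [hθ, hy]
      rw [div_pow]
      field_simp
    have e2 : x ^ Q / (ρ ^ Q) ^ Q = (n : ℝ) ^ (q⁻¹ * Q + (q ^ 2)⁻¹ * (Q * Q)) := by
      rw [hx, hρ, ← pow_mul, ← Real.rpow_natCast, ← Real.rpow_natCast, ← Real.rpow_mul hn0.le,
        ← Real.rpow_mul hn0.le, ← Real.rpow_sub hn0]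
      congr 1
      push_cast
      ring
    rw [e1, e2, mul_div_assoc', div_le_one hn0]
    calc _ ≤ (n : ℝ) ^ (q ^ 2)⁻¹ * ((n : ℝ) ^ q⁻¹
          * (n : ℝ) ^ (q⁻¹ * Q + (q ^ 2)⁻¹ * (Q * Q))) := by gcongr
      _ = (n : ℝ) ^ ((q ^ 2)⁻¹ + (q⁻¹ + (q⁻¹ * Q + (q ^ 2)⁻¹ * (Q * Q)))) := by
          rw [Real.rpow_add hn0 (q ^ 2)⁻¹, Real.rpow_add hn0 q⁻¹]
      _ ≤ (n : ℝ) ^ (1 : ℝ) := by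
          -- The `Q` steps of ratio `y` cost `n ^ (Q / q + Q² / q²)`. This dictates the density `n ^
          -- (-1 / q²)`, and `Q + 1 ≤ q / 2` leaves room for the other factors.
          refine Real.rpow_le_rpow_of_exponent_le hn1 ?_
          have : (q ^ 2)⁻¹ + (q⁻¹ + (q⁻¹ * Q + (q ^ 2)⁻¹ * (Q * Q)))
              = (1 + q + q * Q + Q * Q) / q ^ 2 := by
            field_simp
            ring
          rw [this, div_le_one (by positivity)]
          nlinarith
      _ = n := Real.rpow_one _
  have hpt : ∀ j ≤ Q, max (p : ℝ) 1 * θ j ≤ 1 := fun j hj =>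
    (mul_le_mul_of_nonneg_left (hmono hj) (by positivity)).trans hlast
  have hθ1 : ∀ j ≤ Q, θ j ≤ 1 := fun j hj => by
    have := mul_le_mul_of_nonneg_right (le_max_right (p : ℝ) 1) (hθ0 j).le
    linarith [hpt j hj]
  -- consecutive thresholds
  have hstep : ∀ j ≤ Q, j * θ (j - 1) ≤ Q * θ j / x * ρ ^ j := by
    intro j hj
    rcases Nat.eq_zero_or_pos j with rfl | hpos
    · have := hθ0 0
      simp only [Nat.cast_zero, zero_mul]
      positivity
    · have e : θ j = θ (j - 1) * y := by
        simp only [hθ]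
        conv_lhs => rw [show j = j - 1 + 1 by omega, pow_succ]
        ring
      have hj' : (j : ℝ) ≤ Q := by exact_mod_cast hj
      have ht := hθ0 (j - 1)
      have hpow : ρ ^ Q ≤ ρ ^ j := pow_le_pow_of_le_one h0.le h1 hj
      calc j * θ (j - 1) ≤ Q * θ (j - 1) * 1 := by rw [mul_one]; gcongr
        _ ≤ Q * θ (j - 1) * (ρ ^ j / ρ ^ Q) := by
            gcongr
            rwa [one_le_div hρQ]
        _ = Q * θ j / x * ρ ^ j := by
            rw [e, hy]
            field_simp
  set s : ℕ → ℕ := fun j => ⌊Q / θ j⌋₊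
  -- The largest tuple length that `hstep` permits. It is of order `x * a / Q` times `1 / θ j`,
  -- whereas the logarithm of the number of events is at most a smaller multiple of `1 / θ j`.
  set m : ℕ → ℕ := fun j => ⌊x * a / (Q * θ j)⌋₊
  have hsle : ∀ j, (s j : ℝ) ≤ Q / θ j := fun j =>
    Nat.floor_le (div_nonneg (Nat.cast_nonneg _) (hθ0 j).le)
  have hmle : ∀ j, (m j : ℝ) ≤ x * a / (Q * θ j) := fun j => by
    have := hθ0 j
    exact Nat.floor_le (by positivity)
  refine ⟨⌊20 * ((n : ℝ) * ρ)⌋₊, ?_⟩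
  have hnρ : (n : ℝ) * ρ = (n : ℝ) ^ (1 - (q ^ 2)⁻¹) := by
    rw [sub_eq_add_neg, Real.rpow_add hn0, Real.rpow_one]
  suffices ∃ T : NonAdaptiveAlgorithm Ξ n, T.QueriesAtMost ⌊20 * ((n : ℝ) * ρ)⌋₊ ∧
      T.IsTest ε (1 / 10) L by
    obtain ⟨T, hT⟩ := this
    refine ⟨T, ?_, hT⟩
    rw [← hnρ]
    exact Nat.floor_le (by positivity)
  refine exists_test_of_localAlgorithms (η := ε / 2) (s := s) (m := m) hA hmono hθ0 h0 h1 ha0 hδ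
    ?_ ?_ ?_ ?_ ?_ ?_ hcomp hsound (by omega) (by exact_mod_cast hn0)
    (Nat.lt_floor_add_one _).le
  · have h4 : 4 * a * ((Q : ℝ) + 1) = 1 / 2 := by
      rw [ha]
      field_simp
      norm_num
    have ha1 : a ≤ 1 := by
      rw [ha, div_le_one (by positivity)]
      linarith
    linarith
  · intro j _
    have := Nat.lt_floor_add_one ((Q : ℝ) / θ j)
    rwa [div_lt_iff₀' (hθ0 j)] at this
  · intro j _
    refine (hsle j).trans ?_
    have e : (ε - ε / 2) * n = Q / θ 0 := by
      simp only [hθ, pow_zero, mul_one]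
      field_simp
      norm_num
    rw [e]
    exact div_le_div_of_nonneg_left (by positivity) (hθ0 0) (hmono (Nat.zero_le j))
  · intro j hj
    refine (hstep j hj).trans ?_
    have hQx : Q * θ j / x ≤ a / 20 := by
      rw [div_le_iff₀ (by positivity), ha]
      have : (Q : ℝ) * θ j ≤ Q * 1 := by
        have := hθ1 j hj
        gcongr
      rw [div_div, div_mul_eq_mul_div, le_div_iff₀ (by positivity)]
      nlinarith
    calc Q * θ j / x * ρ ^ j ≤ a / 20 * ρ ^ j := by gcongr
      _ = _ := by ring
  · intro j hj
    have ht := hθ0 j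
    calc m j * j * θ (j - 1) = m j * (j * θ (j - 1)) := by ring
      _ ≤ x * a / (Q * θ j) * (Q * θ j / x * ρ ^ j) := by
          have := hstep j hj
          have h3 := hmle j
          have := hθ0 (j - 1)
          gcongr
      _ = a * ρ ^ j := by field_simp
  · intro j hj
    rw [hΨ]
    refine union_count_le (hθ0 j) hΞ hl (hpt j hj) (hsle j) ?_
    refine le_trans ?_ (Nat.lt_floor_add_one _).le
    have ht := hθ0 j
    rw [div_le_div_iff₀ ht (by positivity), ha]
    have e : x * (1 / (8 * ((Q : ℝ) + 1))) * θ j = x * θ j / (8 * (Q + 1)) := by ring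
    rw [e, le_div_iff₀ (by positivity)]
    nlinarith [mul_le_mul_of_nonneg_right hx3 ht.le]

/-- Here `20 / (1/2 - 1/3)² = 720`, and the amplified verifier makes at most `300 * q' * max 1 (log
q')` queries; of the triple logarithm factor only the lower bound `1` matters. -/
theorem qParam_bounds {q' k : ℕ} (ε : ℝ) (hq' : 1 ≤ q') :
    720 ≤ qParam q' k ε ∧
      ((2 * (75 * (Nat.log 2 q' + 1)) * q' : ℕ) : ℝ) + 1 ≤ qParam q' k ε / 2 := by
  have h1 : (1 : ℝ) ≤ q' := by exact_mod_cast hq'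
  have hlog := Real.natLog_le_logb q' 2
  push_cast at hlog
  unfold qParam
  set l2 := max 1 (Real.logb 2 q')
  set l3 := max 1 (Real.logb 2 (Real.logb 2 (Real.logb 2 (k / ε))))
  have h2 : 1 ≤ l2 := le_max_left _ _
  have h3 : 1 ≤ l3 := le_max_left _ _
  have h4 : (Nat.log 2 q' : ℝ) ≤ l2 := hlog.trans (le_max_right _ _)
  have h5 : 1 ≤ q' * l2 := by nlinarith
  have h6 : q' * l2 ≤ q' * l2 * l3 := le_mul_of_one_le_right (by linarith) h3
  have e : 20 * q' * l2 * l3 / (1 / 2 - 1 / 3 : ℝ) ^ 2 = 720 * (q' * l2 * l3) := by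
    norm_num
    ring
  rw [e]
  refine ⟨by linarith, ?_⟩
  push_cast
  nlinarith

theorem one_le_alphaTwo {k : ℕ} {q ε : ℝ} (hk : 2 ≤ k) (hq : 1 ≤ q) (hε : 0 < ε)
    (hε1 : ε ≤ 1) : 1 ≤ alphaTwo q k ε := by
  have h1 : Real.log 2 ≤ Real.log k := Real.log_le_log two_pos (by exact_mod_cast hk)
  have h2 := Real.log_two_gt_d9
  have h3 : 1 ≤ q ^ 4 := one_le_pow₀ hq
  rw [alphaTwo, one_le_div hε]
  nlinarith

/-- A property with a Merlin-Arthur proof of proximity has a sublinear non-adaptive test. -/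
theorem IsMAP.exists_test {p q' : ℕ} {V : (Fin p → Ξ) → PMF (QueryTree Ξ n)}
    {L : Set (Fin n → Ξ)} {q ε : ℝ} (hV : IsMAP V L (ε / 2) q') (hΞ : 2 ≤ Fintype.card Ξ)
    (hε : 0 < ε) (hε1 : ε ≤ 1) (hq' : 1 ≤ q') (hq : q = qParam q' (Fintype.card Ξ) ε)
    (hn : (24 * q ^ 10 * (Real.logb 2 (Fintype.card Ξ)) ^ 2 / ε) ^ q < (n : ℝ)) :
    ∃ (N : ℕ) (T : NonAdaptiveAlgorithm Ξ n),
      (N : ℝ) ≤ 20 * max (p : ℝ) 1 * (n : ℝ) ^ (1 - (q ^ 2)⁻¹) ∧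
      T.QueriesAtMost N ∧ T.IsTest ε (1 / 10) L := by
  obtain ⟨hq720, hQ⟩ := qParam_bounds (k := Fintype.card Ξ) ε hq'
  rw [← hq] at hq720 hQ
  have hq0 : 0 < q := by linarith
  have hn0 : (0 : ℝ) < n := lt_of_le_of_lt (by positivity) hn
  have hp1 : (1 : ℝ) ≤ max (p : ℝ) 1 := le_max_right _ _
  have hpow : (0 : ℝ) < (n : ℝ) ^ (1 - (q ^ 2)⁻¹) := by positivity
  -- For longer proofs the claimed bound is at least `n`, and reading the whole word suffices.
  rcases le_total (max (p : ℝ) 1) ((n : ℝ) ^ (q ^ 2)⁻¹) with hp | hp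
  · set r := 75 * (Nat.log 2 q' + 1)
    set A : (Fin p → Ξ) → LocalAlgorithm (Fin (2 * r) → Behaviour Ξ n q') Ξ n :=
      fun π => (localAlgorithmOfTrees q' (V π)).amplify r
    have hacc : ∀ π w, (localAlgorithmOfTrees q' (V π)).acceptProb w
        = treeAcceptProb (V π) w := fun π w =>
      acceptProb_localAlgorithmOfTrees (hV.queries π) w
    have hcomp : ∀ w ∈ L, ∃ π, 1 - (8 / 9) ^ r ≤ (A π).acceptProb w := by
      intro w hw
      obtain ⟨π, hπ⟩ := hV.completeness w hw
      exact ⟨π, LocalAlgorithm.le_acceptProb_amplify _ r ((hacc π w).symm ▸ hπ)⟩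
    have hsound : ∀ w, FarFrom (ε / 2) w L → ∀ π, (A π).acceptProb w ≤ (8 / 9) ^ r :=
      fun w hw π => LocalAlgorithm.acceptProb_amplify_le _ r
        ((hacc π w).symm ▸ hV.soundness w hw π)
    obtain ⟨N, T, hN, hT⟩ := exists_sample_test (p := p)
      (fun π => (queriesAtMost_localAlgorithmOfTrees q' (V π)).amplify r)
      (Nat.mul_pos (by omega) hq') hq720 hQ
      (error_le _ q' (by omega) (Nat.lt_pow_succ_log_self one_lt_two q').le) hε hε1 hΞ
      (by simp) hn hp hcomp hsound
    refine ⟨N, T, hN.trans ?_, hT⟩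
    nlinarith
  · obtain ⟨T, hT⟩ := exists_test_reading_all L hε.le
    refine ⟨n, T, ?_, hT⟩
    calc (n : ℝ) = (n : ℝ) ^ (q ^ 2)⁻¹ * (n : ℝ) ^ (1 - (q ^ 2)⁻¹) := by
          rw [← Real.rpow_add hn0, add_sub_cancel, Real.rpow_one]
      _ ≤ max (p : ℝ) 1 * (n : ℝ) ^ (1 - (q ^ 2)⁻¹) := by gcongr
      _ ≤ _ := by nlinarith [mul_pos (lt_of_lt_of_le one_pos hp1) hpow]

end Main

end PropertyTesting

end

/-! ### Comparison with the lower bound for tests -/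

theorem mainTheorem9 (c : ℝ) (hc : 0 < c) :
    ∃ c' : ℝ, 0 < c' ∧
      ∀ (Ξ : Type*) [Fintype Ξ] (ε γ : ℝ) (q' n : ℕ) (q : ℝ),
        2 ≤ Fintype.card Ξ → 0 < ε → ε ≤ 1 → 1 ≤ q' →
        q = PropertyTesting.qParam q' (Fintype.card Ξ) ε →
        (24 * q ^ 10 * (Real.logb 2 (Fintype.card Ξ)) ^ 2 / ε) ^ q < (n : ℝ) →
        ∀ L : Set (Fin n → Ξ),
          PropertyTesting.NonAdaptiveTestsNeed L ε (1 / 10) (c * (n : ℝ) ^ (1 - γ)) →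
          ∀ (p : ℕ) (V : (Fin p → Ξ) → PMF (PropertyTesting.QueryTree Ξ n)),
            PropertyTesting.IsMAP V L (ε / 2) q' →
            c' * ((n : ℝ) ^ ((q ^ 2)⁻¹ - γ) /
                (10 * PropertyTesting.alphaTwo q (Fintype.card Ξ) ε)) ≤ max (p : ℝ) 1 := by
  -- The `20` is the constant in the query bound of the test, coming from Markov's inequality for
  -- the sample size. The denominator `10 * α₂ ≥ 1` only weakens the claim.
  refine ⟨c / 20, by positivity, ?_⟩
  intro Ξ _ ε γ q' n q hΞ hε hε1 hq' hq hn L hneed p V hV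
  obtain ⟨N, T, hN, hTN, hT⟩ := hV.exists_test hΞ hε hε1 hq' hq hn
  have hq720 := (PropertyTesting.qParam_bounds (k := Fintype.card Ξ) ε hq').1
  rw [← hq] at hq720
  have hq0 : 0 < q := by linarith
  have hn0 : (0 : ℝ) < n := lt_of_le_of_lt (by positivity) hn
  have hα := PropertyTesting.one_le_alphaTwo hΞ (by linarith : 1 ≤ q) hε hε1
  have hpow : (0 : ℝ) < (n : ℝ) ^ (1 - (q ^ 2)⁻¹) := by positivity
  have hexp : (n : ℝ) ^ (1 - γ) = (n : ℝ) ^ ((q ^ 2)⁻¹ - γ) * (n : ℝ) ^ (1 - (q ^ 2)⁻¹) := by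
    rw [← Real.rpow_add hn0]
    congr 1
    ring
  have h := (hneed T N hTN hT).trans hN
  rw [hexp, ← mul_assoc] at h
  have h2 := le_of_mul_le_mul_right h hpow
  have h3 : (n : ℝ) ^ ((q ^ 2)⁻¹ - γ) / (10 * PropertyTesting.alphaTwo q (Fintype.card Ξ) ε)
      ≤ (n : ℝ) ^ ((q ^ 2)⁻¹ - γ) := div_le_self (by positivity) (by linarith)
  calc _ ≤ c / 20 * (n : ℝ) ^ ((q ^ 2)⁻¹ - γ) := by gcongr
    _ ≤ _ := by linarith
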